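/- Consider the symmetric linear computation broadcast problem over $\mathbb F_q$, $q=p^n$ ($p$ prime), with $K\ge 1$ users and data dimension $d$. An instance $\Lambda$ consists of matrices $\mathbf v_k\in\mathbb F_q^{d\times m}$ (demands) and $\mathbf v'_k\in\mathbb F_q^{d\times m'}$ (side information), $k=1,\dots,K$. An achievable scheme consists of a batch size $L\ge1$, a finite alphabet $\mathcal S$, an encoder $\Phi:\mathbb F_q^{d\times L}\to\mathcal S$ and decoders $\Psi_k$ with $\Psi_k(\Phi(\mathbf x),\mathbf x^T\mathbf v_k')=\mathbf x^T\mathbf v_k$ for all $k$ and all $\mathbf x\in\mathbb F_q^{d\times L}$; its cost is $\log_q|\mathcal S|/L$, and $\Delta^*(\Lambda)$ is the infimum of the costs of the achievable schemes. Let $\Lambda_n$ be a uniformly random instance over $\mathbb F_{p^n}$. If $\Delta^*(\Lambda_n)$ converges in probability, as $n\to\infty$, to a constant $\Delta_g$, then we say that the generic capacity $C_g(p,K,d,m,m')=1/\Delta_g$ exists. Compare $C_g$ with the better of the two baseline rates $1/(d-m')$ (random coding) and $1/(Km)$ (separate transmissions), for integers $m\ge1$ and $0\le m'<d$. Put $$\rho(p,K,d,m,m')=\frac{C_g(p,K,d,m,m')}{\max\{\frac1{d-m'},\frac1{Km}\}},\qquad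 \tilde\rho(K,d,m,m')=\frac{\frac{m+m'}{md}}{\max\{\frac1{d-m'},\frac1{Km}\}}.$$ (1) For every $K\ge1$, the extremal gain as a function of the number of users is $$\eta_K=\sup_{p,d,m,m'}\rho(p,K,d,m,m')=\sup_{d,m,m'}\tilde\rho(K,d,m,m')=K,$$ where the first supremum is over all parameters for which $C_g$ exists. (2) For every $d\ge1$, let $\eta_d=\sup_{p,K,m,m'}\rho(p,K,d,m,m')$ be the extremal gain as a function of the data dimension, the supremum being over all parameters ($K\ge1$) for which $C_g$ exists. Then $\eta_d\ge d/4$ for every $d\ge 1$, and $\eta_d\in[d/4,\,d/4+1]$ for every $d\ge1$ other than $3$ and $7$; moreover $\eta_3=2$ and $\eta_7=3$. If the supremum is restricted to large numbers of users, $K\ge d/\gcd(d,m+m')$, then it lies in $[d/4,\,d/4+1]$ for every $d\ge1$. Likewise $\sup_{K,m,m'}\tilde\rho(K,d,m,m')\in[d/4,\,d/4+1]$ for every $d\ge1$. -/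

import Mathlib

open Filter Topology
open scoped ENNReal

namespace LCBC

noncomputable section

/-- A symmetric linear computation broadcast instance over the field `F`: `K` users and
`d`-dimensional data; user `k` wants `m` linear combinations of the data (the columns of
`demand k`) and already holds `m'` linear combinations of them (the columns of `side k`). -/
abbrev Inst (F : Type) (K d m m' : ℕ) : Type :=
  (Fin K → Matrix (Fin d) (Fin m) F) × (Fin K → Matrix (Fin d) (Fin m') F)

/-- The demand coefficient matrix `v_k` of user `k`. -/
def Inst.demand {F : Type} {K d m m' : ℕ} (I : Inst F K d m m') (k : Fin K) :
    Matrix (Fin d) (Fin m) F := I.1 k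

/-- The side-information coefficient matrix `v'_k` of user `k`. -/
def Inst.side {F : Type} {K d m m' : ℕ} (I : Inst F K d m m') (k : Fin K) :
    Matrix (Fin d) (Fin m') F := I.2 k

/-- An achievable coding scheme for an instance: a batch size `L ≥ 1`, a finite broadcast alphabet,
an arbitrary encoder, and arbitrary decoders, such that every user recovers its demand from the
broadcast symbol and its side information, for every realization `x` of the data. -/
structure Scheme {F : Type} [Field F] {K d m m' : ℕ} (I : Inst F K d m m') where
  L : ℕ
  L_pos : 0 < L
  Alphabet : Type
  fintypeAlphabet : Fintype Alphabet
  encode : Matrix (Fin d) (Fin L) F → Alphabet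
  decode : Fin K → Alphabet → Matrix (Fin L) (Fin m') F → Matrix (Fin L) (Fin m) F
  correct : ∀ (k : Fin K) (x : Matrix (Fin d) (Fin L) F),
    decode k (encode x) (x.transpose * I.side k) = x.transpose * I.demand k

/-- The broadcast cost `log_q |S| / L` of a scheme, where `q = |F|`. -/
def Scheme.cost {F : Type} [Field F] {K d m m' : ℕ} {I : Inst F K d m m'} (s : Scheme I) : ℝ :=
  Real.logb (Nat.card F) (Nat.card s.Alphabet) / s.L

/-- The optimal broadcast cost `Δ*` of an instance. -/
def optCost {F : Type} [Field F] {K d m m' : ℕ} (I : Inst F K d m m') : ℝ :=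
  sInf (Set.range fun s : Scheme I => s.cost)

/-- The probability that a uniformly random element of the finite type `α` satisfies `P`. -/
def prob (α : Type) (P : α → Prop) : ℝ :=
  (Nat.card {a : α // P a} : ℝ) / Nat.card α

/-- `Δ` is the generic optimal broadcast cost for the parameters `p, K, d, m, m'`: the optimal cost
of a uniformly random instance over the field with `p ^ n` elements converges to `Δ` in probability
as `n → ∞`. -/
def IsGenericCost (p : ℕ) [Fact p.Prime] (K d m m' : ℕ) (Δ : ℝ) : Prop :=
  ∀ ε : ℝ, 0 < ε →
    Tendsto (fun n : ℕ => prob (Inst (GaloisField p n) K d m m') fun I => |optCost I - Δ| < ε)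
      atTop (𝓝 1)

/-- `C` is the generic capacity (the reciprocal of the generic optimal broadcast cost,
with `1 / 0 = ∞`) for the parameters `p, K, d, m, m'`; in particular this says that it exists. -/
def IsGenericCapacity (p : ℕ) [Fact p.Prime] (K d m m' : ℕ) (C : ℝ≥0∞) : Prop :=
  ∃ Δ : ℝ, IsGenericCost p K d m m' Δ ∧ C = 1 / ENNReal.ofReal Δ

/-- The better of the rates of the two baseline schemes, random coding `1 / (d - m')⁺` and
separate transmissions `1 / (K m)` (with `1 / 0 = ∞`). The natural number subtraction is the
positive part. -/
def baselineRate (K d m m' : ℕ) : ℝ≥0∞ :=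
  max (1 / ((d - m' : ℕ) : ℝ≥0∞)) (1 / ((K : ℝ≥0∞) * m))

/-- The expression `(m + m') / (m d)`. -/
def envelopeRate (d m m' : ℕ) : ℝ≥0∞ :=
  ((m : ℝ≥0∞) + m') / ((m : ℝ≥0∞) * d)

/-- `K` users suffice for the large-number-of-users regime: `K ≥ d / gcd(d, m + m')`. -/
def ManyUsers (K d m m' : ℕ) : Prop := d / Nat.gcd d (m + m') ≤ K

/-- Extremal gain of the generic capacity over the baseline schemes as a function of `K`: the
supremum over all primes `p` and all `d, m, m'` with `m ≥ 1` and `m' < d` (so that the baseline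
rates are finite) for which the generic capacity exists. -/
def gainUsers (K : ℕ) : ℝ≥0∞ :=
  sSup {g | ∃ (p : ℕ) (_ : Fact p.Prime) (d m m' : ℕ) (C : ℝ≥0∞),
    0 < m ∧ m' < d ∧ IsGenericCapacity p K d m m' C ∧ g = C / baselineRate K d m m'}

/-- Extremal gain as a function of the data dimension `d`: the supremum over all primes `p` and
all `K ≥ 1`, `m ≥ 1`, `m' < d` for which the generic capacity exists. -/
def gainDim (d : ℕ) : ℝ≥0∞ :=
  sSup {g | ∃ (p : ℕ) (_ : Fact p.Prime) (K m m' : ℕ) (C : ℝ≥0∞),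
    0 < K ∧ 0 < m ∧ m' < d ∧ IsGenericCapacity p K d m m' C ∧ g = C / baselineRate K d m m'}

/-- As `gainDim`, with the supremum restricted to the large-number-of-users regime. -/
def gainDimManyUsers (d : ℕ) : ℝ≥0∞ :=
  sSup {g | ∃ (p : ℕ) (_ : Fact p.Prime) (K m m' : ℕ) (C : ℝ≥0∞),
    0 < K ∧ 0 < m ∧ m' < d ∧ ManyUsers K d m m' ∧ IsGenericCapacity p K d m m' C ∧
      g = C / baselineRate K d m m'}

/-- As `gainUsers`, with the generic capacity replaced by `(m + m') / (m d)`. -/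
def envelopeGainUsers (K : ℕ) : ℝ≥0∞ :=
  sSup {g | ∃ d m m' : ℕ, 0 < m ∧ m' < d ∧ g = envelopeRate d m m' / baselineRate K d m m'}

/-- As `gainDim`, with the generic capacity replaced by `(m + m') / (m d)`. -/
def envelopeGainDim (d : ℕ) : ℝ≥0∞ :=
  sSup {g | ∃ K m m' : ℕ, 0 < K ∧ 0 < m ∧ m' < d ∧
    g = envelopeRate d m m' / baselineRate K d m m'}

end

end LCBC

/-! Every gain is `min (d - m') (K * m) / Δ` with `Δ` the generic cost, so upper bounds on gains are
lower bounds on `Δ`, and extremal examples are parameters whose `Δ` is known exactly.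

Converse. For a fixed scheme, let `f W` be the mutual information between the broadcast symbol and
the combinations of the data with coefficients in `W`. It is supermodular, `f ⊤` is at most the
logarithm of the alphabet size, and decodability bounds `f` from below on the span of each user's
columns. If these spans have dimension `u = m + m' ≤ d` and are in general position, they can be
combined one at a time: while the dimensions still fit, take the sum; otherwise the sum is
everything, one copy of `f ⊤` is paid, and the intersection is kept. Hence `k * m ≤ c * Δ` whenever
`k ≤ K` and `k * u ≤ c * d` (`mul_le_of_isGeneric`, `IsGenericCost.mul_le`); for `u ≥ d` a single
user gives `d - m' ≤ Δ` (`IsGenericCost.sub_le`).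

Achievability, always with `m = 1`. If `K = r + 1`, `d = r * (r + 1) + 1`, `m' = r * r`, the user
spans meet in a line, and broadcasting the combination along it serves everyone at cost `1`
(`isGenericCost_one`); the gain is `r + 1`, which settles the bound in `K` and the lower bounds at
`d = 3, 7`. If `K ≥ d`, interference alignment over the prime subfield attains `d / (m' + 1)`
(`isGenericCost_of_le`); with `m'` near `d / 2` the gain is at least `d / 4`.

Upper bounds in `d`. With many users, `k / c = d / (m + m')` is available and `sub_mul_add_le`
finishes. With few users only integral `c` is available: at most `y = d - u + 1` users matter, and
`y * u ≤ (d + 1) ^ 2 / 4` allows `c = ⌊d / 4⌋ + 1` unless `d = 4 * j + 3`. There one user may have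
to be dropped, which costs little enough exactly when `j ≥ 2`
(`IsGenericCost.le_mul_of_three_mod_four`). -/

namespace LCBC

noncomputable section

/-! ### Entropy of equivalence relations -/

section Entropy

open Classical in
/-- The size of the equivalence class of `x`. -/
def classCard {X : Type*} [Fintype X] (r : Setoid X) (x : X) : ℕ :=
  (Finset.univ.filter fun y => r x y).card

/-- The sum over all points of the logarithms of the sizes of their classes. If `x` is uniformly
distributed, this is `|X|` times the conditional entropy of `x` given its class. -/
def logClass {X : Type*} [Fintype X] (r : Setoid X) : ℝ := ∑ x, Real.log (classCard r x)

variable {X : Type*} [Fintype X]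

theorem classCard_pos (r : Setoid X) (x : X) : 0 < classCard r x :=
  Finset.card_pos.2 ⟨x, by simp⟩

theorem classCard_congr (r : Setoid X) {x y : X} (h : r x y) : classCard r x = classCard r y := by
  classical
  unfold classCard
  congr 1
  ext z
  simp only [Finset.mem_filter, Finset.mem_univ, true_and]
  exact ⟨fun hz => r.trans' (r.symm' h) hz, fun hz => r.trans' h hz⟩

theorem classCard_mono {r s : Setoid X} (h : r ≤ s) (x : X) : classCard r x ≤ classCard s x := by
  classical
  exact Finset.card_le_card fun y hy => by
    simp only [Finset.mem_filter, Finset.mem_univ, true_and] at hy ⊢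
    exact h hy

theorem logClass_mono {r s : Setoid X} (h : r ≤ s) : logClass r ≤ logClass s :=
  Finset.sum_le_sum fun x _ => Real.log_le_log (by exact_mod_cast classCard_pos r x)
    (by exact_mod_cast classCard_mono h x)

open Classical in
theorem sum_ite_div_classCard (r : Setoid X) (y : X) :
    ∑ x, (if r y x then (1 : ℝ) / classCard r x else 0) = 1 := by
  have h : ∀ x, (if r y x then (1 : ℝ) / classCard r x else 0) =
      if r y x then (1 : ℝ) / classCard r y else 0 := by
    intro x
    split_ifs with hx
    · rw [classCard_congr r hx]
    · rfl
  simp only [h]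
  rw [← Finset.sum_filter, Finset.sum_const, nsmul_eq_mul]
  have := classCard_pos r y
  have h0 : (classCard r y : ℝ) ≠ 0 := by positivity
  change (classCard r y : ℝ) * (1 / classCard r y) = 1
  field_simp

/-- The numerator counts pairs `(y, z)` with `y` in the `a`-class and `z` in the `b`-class of `x`.
For a fixed pair the admissible `x` are empty or one class of `a ⊓ b`, so their weights add up to `1
/ classCard c z`, and `z` lies in the `c`-class of `y`. Summing over `z` gives at most `1` for each
`y`. -/
theorem sum_classCard_ratio_le {a b c : Setoid X} (hac : a ≤ c) (hbc : b ≤ c) :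
    ∑ x, (classCard a x * classCard b x : ℝ) / (classCard (a ⊓ b) x * classCard c x) ≤
      Fintype.card X := by
  classical
  have e1 : ∀ x, (classCard a x * classCard b x : ℝ) / (classCard (a ⊓ b) x * classCard c x) =
      ∑ y, ∑ z, if a y x ∧ b z x then
        (1 : ℝ) / (classCard (a ⊓ b) x * classCard c x) else 0 := by
    intro x
    have ha : (classCard a x : ℝ) = ∑ y, if a y x then (1 : ℝ) else 0 := by
      rw [Finset.sum_boole, classCard]
      simp only [a.comm']
    have hb : (classCard b x : ℝ) = ∑ y, if b y x then (1 : ℝ) else 0 := by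
      rw [Finset.sum_boole, classCard]
      simp only [b.comm']
    rw [ha, hb, Finset.sum_mul_sum, Finset.sum_div]
    refine Finset.sum_congr rfl fun y _ => ?_
    rw [Finset.sum_div]
    refine Finset.sum_congr rfl fun z _ => ?_
    by_cases h1 : a y x <;> by_cases h2 : b z x <;> simp [h1, h2]
  simp only [e1]
  rw [Finset.sum_comm]
  have e2 : ∀ y : X, ∑ x, ∑ z, (if a y x ∧ b z x then
        (1 : ℝ) / (classCard (a ⊓ b) x * classCard c x) else 0) ≤ 1 := by
    intro y
    rw [Finset.sum_comm]
    refine le_of_le_of_eq (Finset.sum_le_sum fun z _ => ?_) (sum_ite_div_classCard c y)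
    by_cases hne : ∃ x0, a y x0 ∧ b z x0
    · obtain ⟨x0, hx0, hz0⟩ := hne
      have hyz : c y z := c.trans' (hac hx0) (c.symm' (hbc hz0))
      rw [if_pos hyz]
      have hc : classCard c z = classCard c x0 := classCard_congr c (hbc hz0)
      have : ∀ x, (if a y x ∧ b z x then
          (1 : ℝ) / (classCard (a ⊓ b) x * classCard c x) else 0) =
          (if (a ⊓ b) x0 x then (1 : ℝ) / classCard (a ⊓ b) x else 0) * (1 / classCard c z) := by
        intro x
        have hiff : (a y x ∧ b z x) ↔ (a ⊓ b) x0 x := by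
          constructor
          · rintro ⟨h1, h2⟩
            exact ⟨a.trans' (a.symm' hx0) h1, b.trans' (b.symm' hz0) h2⟩
          · rintro ⟨h1, h2⟩
            exact ⟨a.trans' hx0 h1, b.trans' hz0 h2⟩
        by_cases hx : (a ⊓ b) x0 x
        · rw [if_pos (hiff.2 hx), if_pos hx, classCard_congr c (hbc (hiff.2 hx).2)]
          rw [one_div_mul_one_div]
        · rw [if_neg (fun h => hx (hiff.1 h)), if_neg hx, zero_mul]
      simp only [this]
      rw [← Finset.sum_mul, sum_ite_div_classCard, one_mul]
    · have : ∀ x, ¬ (a y x ∧ b z x) := fun x hx => hne ⟨x, hx⟩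
      simp only [this, if_false, Finset.sum_const_zero]
      split_ifs <;> positivity
  calc _ ≤ ∑ y : X, (1 : ℝ) := Finset.sum_le_sum fun y _ => e2 y
    _ = Fintype.card X := by simp

/-- Submodularity of entropy. -/
theorem logClass_add_le {a b c : Setoid X} (hac : a ≤ c) (hbc : b ≤ c) :
    logClass a + logClass b ≤ logClass (a ⊓ b) + logClass c := by
  have h := sum_classCard_ratio_le hac hbc
  have hlog : ∀ x, Real.log (classCard a x) + Real.log (classCard b x) -
      (Real.log (classCard (a ⊓ b) x) + Real.log (classCard c x)) ≤
      (classCard a x * classCard b x : ℝ) / (classCard (a ⊓ b) x * classCard c x) - 1 := by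
    intro x
    have ha : (0 : ℝ) < classCard a x := by exact_mod_cast classCard_pos a x
    have hb : (0 : ℝ) < classCard b x := by exact_mod_cast classCard_pos b x
    have hc : (0 : ℝ) < classCard c x := by exact_mod_cast classCard_pos c x
    have hab : (0 : ℝ) < classCard (a ⊓ b) x := by exact_mod_cast classCard_pos (a ⊓ b) x
    rw [← Real.log_mul ha.ne' hb.ne', ← Real.log_mul hab.ne' hc.ne',
      ← Real.log_div (by positivity) (by positivity)]
    exact Real.log_le_sub_one_of_pos (by positivity)
  have hs := Finset.sum_le_sum fun x (_ : x ∈ Finset.univ) => hlog x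
  simp only [Finset.sum_sub_distrib, Finset.sum_add_distrib] at hs
  have h1 : ∑ _x : X, (1 : ℝ) = Fintype.card X := by simp
  simp only [logClass]
  linarith

/-- This says that the entropy of `g x` is at most `log |S|`. It follows from `log t ≤ t - 1`, since
the reciprocals of the class sizes sum to the number of attained values. -/
theorem card_mul_log_sub_le {S : Type*} [Fintype S] (g : X → S) [Nonempty X] :
    Fintype.card X * (Real.log (Fintype.card X) - Real.log (Fintype.card S)) ≤
      logClass (Setoid.ker g) := by
  classical
  have hX : (0 : ℝ) < Fintype.card X := by exact_mod_cast Fintype.card_pos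
  have hS : (0 : ℝ) < Fintype.card S := by
    have : Nonempty S := ‹Nonempty X›.map g
    exact_mod_cast Fintype.card_pos
  have hlog : ∀ x, Real.log (Fintype.card X) - Real.log (Fintype.card S) -
      Real.log (classCard (Setoid.ker g) x) ≤
      Fintype.card X / Fintype.card S * (1 / classCard (Setoid.ker g) x) - 1 := by
    intro x
    have hc : (0 : ℝ) < classCard (Setoid.ker g) x := by
      exact_mod_cast classCard_pos (Setoid.ker g) x
    rw [← Real.log_div hX.ne' hS.ne', ← Real.log_div (by positivity) hc.ne']
    refine (Real.log_le_sub_one_of_pos (by positivity)).trans (le_of_eq ?_)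
    rw [div_div, div_mul_div_comm, mul_one]
  have hs := Finset.sum_le_sum fun x (_ : x ∈ Finset.univ) => hlog x
  have hr : ∑ x, (1 : ℝ) / classCard (Setoid.ker g) x ≤ Fintype.card S := by
    have : ∑ x, (1 : ℝ) / classCard (Setoid.ker g) x =
        ∑ s : S, ∑ x, if g x = s then (1 : ℝ) / classCard (Setoid.ker g) x else 0 := by
      rw [Finset.sum_comm]
      simp
    rw [this]
    calc _ ≤ ∑ s : S, (1 : ℝ) := by
          refine Finset.sum_le_sum fun s _ => ?_
          by_cases hs : ∃ y, g y = s
          · obtain ⟨y, rfl⟩ := hs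
            refine le_of_eq ((Finset.sum_congr rfl fun x _ => ?_).trans
              (sum_ite_div_classCard (Setoid.ker g) y))
            by_cases h : g x = g y
            · rw [if_pos h, if_pos (Setoid.ker_def.2 h.symm)]
            · rw [if_neg h, if_neg (fun h' => h (Setoid.ker_def.1 h').symm)]
          · have : ∀ x, ¬ g x = s := fun x hx => hs ⟨x, hx⟩
            simp [this]
      _ = Fintype.card S := by simp
  simp only [Finset.sum_sub_distrib, Finset.sum_const, ← Finset.mul_sum, Finset.card_univ,
    nsmul_eq_mul] at hs
  have : (Fintype.card X : ℝ) / Fintype.card S *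
      ∑ x, (1 : ℝ) / classCard (Setoid.ker g) x ≤ Fintype.card X := by
    calc _ ≤ (Fintype.card X : ℝ) / Fintype.card S * Fintype.card S := by gcongr
      _ = _ := by field_simp
  simp only [logClass]
  linarith

theorem logClass_bot : logClass (⊥ : Setoid X) = 0 := by
  classical
  refine Finset.sum_eq_zero fun x _ => ?_
  have : classCard (⊥ : Setoid X) x = 1 := by
    unfold classCard
    rw [Finset.card_eq_one]
    exact ⟨x, by ext y; simp [eq_comm]⟩
  simp [this]

theorem logClass_top : logClass (⊤ : Setoid X) = Fintype.card X * Real.log (Fintype.card X) := by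
  classical
  have : ∀ x, classCard (⊤ : Setoid X) x = Fintype.card X := by
    intro x
    unfold classCard
    rw [Finset.filter_true_of_mem (fun y _ => by simp [Setoid.top_def])]
    rfl
  simp [logClass, this]

end Entropy

/-! ### Linear observations of the data -/

section Observation

variable {F : Type} [Field F] {d L : ℕ}

/-- Two data matrices are related if all their combinations with coefficient vectors in `W`
agree. -/
def obs (L : ℕ) (W : Submodule F (Fin d → F)) : Setoid (Matrix (Fin d) (Fin L) F) where
  r x y := ∀ w ∈ W, x.transpose.mulVec w = y.transpose.mulVec w
  iseqv := ⟨fun _ _ _ => rfl, fun h w hw => (h w hw).symm,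
    fun h h' w hw => (h w hw).trans (h' w hw)⟩

theorem obs_anti {A B : Submodule F (Fin d → F)} (h : A ≤ B) : obs L B ≤ obs L A :=
  fun {_ _} hxy w hw => hxy w (h hw)

theorem obs_sup (A B : Submodule F (Fin d → F)) : obs L (A ⊔ B) = obs L A ⊓ obs L B := by
  refine le_antisymm (le_inf (obs_anti le_sup_left) (obs_anti le_sup_right)) ?_
  rintro x y ⟨ha, hb⟩ w hw
  obtain ⟨a, haA, b, hbB, rfl⟩ := Submodule.mem_sup.1 hw
  rw [Matrix.mulVec_add, Matrix.mulVec_add, ha a haA, hb b hbB]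

theorem obs_bot : obs L (⊥ : Submodule F (Fin d → F)) = ⊤ := by
  refine eq_top_iff.2 fun {x y} _ w hw => ?_
  rw [(Submodule.mem_bot F).1 hw, Matrix.mulVec_zero, Matrix.mulVec_zero]

theorem obs_top : obs L (⊤ : Submodule F (Fin d → F)) = ⊥ := by
  refine eq_bot_iff.2 fun {x y} h => ?_
  change x = y
  ext i j
  have := congrFun (h (Pi.single i 1) trivial) j
  simpa using this

theorem obs_span_iff {ι : Type*} (v : ι → Fin d → F) (x y : Matrix (Fin d) (Fin L) F) :
    obs L (Submodule.span F (Set.range v)) x y ↔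
      ∀ i, x.transpose.mulVec (v i) = y.transpose.mulVec (v i) := by
  constructor
  · exact fun h i => h _ (Submodule.subset_span ⟨i, rfl⟩)
  · intro h w hw
    induction hw using Submodule.span_induction with
    | mem w hw => obtain ⟨i, rfl⟩ := hw; exact h i
    | zero => simp
    | add a b _ _ ha hb => rw [Matrix.mulVec_add, Matrix.mulVec_add, ha, hb]
    | smul c a _ ha => rw [Matrix.mulVec_smul, Matrix.mulVec_smul, ha]

variable [Fintype F]

theorem card_orthogonal (W : Submodule F (Fin d → F)) :
    Nat.card {x : Fin d → F // ∀ w ∈ W, x ⬝ᵥ w = 0} =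
      Fintype.card F ^ (d - Module.finrank F W) := by
  have e : {x : Fin d → F // ∀ w ∈ W, x ⬝ᵥ w = 0} ≃ W.dualAnnihilator :=
    (dotProductEquiv F (Fin d)).toEquiv.subtypeEquiv fun x => by
      simp [Submodule.mem_dualAnnihilator, dotProductEquiv]
  rw [Nat.card_congr e, Module.natCard_eq_pow_finrank (K := F), Nat.card_eq_fintype_card]
  congr 1
  have := Subspace.finrank_add_finrank_dualAnnihilator_eq W
  simp only [Module.finrank_fintype_fun_eq_card, Fintype.card_fin] at this
  omega

/-- A class is a coset: each of the `L` columns may be shifted independently by a vector orthogonal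
to `W`. -/
theorem classCard_obs (W : Submodule F (Fin d → F))
    (x : Matrix (Fin d) (Fin L) F) :
    classCard (obs L W) x = Fintype.card F ^ (L * (d - Module.finrank F W)) := by
  classical
  have h1 : classCard (obs L W) x = Nat.card {y // obs L W x y} := by
    rw [Nat.card_eq_fintype_card, Fintype.card_subtype]; rfl
  have e : {y // obs L W x y} ≃ (Fin L → {x : Fin d → F // ∀ w ∈ W, x ⬝ᵥ w = 0}) :=
    { toFun := fun y l => ⟨fun i => y.1 i l - x i l, fun w hw => by
        have := congrFun (y.2 w hw) l
        simp only [Matrix.mulVec, Matrix.transpose_apply, dotProduct] at this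
        simp only [dotProduct, sub_mul, Finset.sum_sub_distrib, this, sub_self]⟩
      invFun := fun z => ⟨fun i l => x i l + (z l).1 i, fun w hw => by
        funext l
        have := (z l).2 w hw
        simp only [dotProduct] at this
        change ∑ i, x i l * w i = ∑ i, (x i l + (z l).1 i) * w i
        simp only [add_mul, Finset.sum_add_distrib, this, add_zero]⟩
      left_inv := fun y => by ext i l; simp
      right_inv := fun z => by ext l i; simp }
  rw [h1, Nat.card_congr e, Nat.card_pi]
  simp only [card_orthogonal, Finset.prod_const, Finset.card_univ, Fintype.card_fin]
  rw [← pow_mul, mul_comm]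

theorem logClass_obs (W : Submodule F (Fin d → F)) :
    logClass (obs L W) = Fintype.card (Matrix (Fin d) (Fin L) F) *
      (L * ((d : ℝ) - Module.finrank F W) * Real.log (Fintype.card F)) := by
  have hle : Module.finrank F W ≤ d := by
    simpa using Submodule.finrank_le W
  simp only [logClass, classCard_obs, Finset.sum_const, Finset.card_univ, nsmul_eq_mul]
  push_cast
  rw [Real.log_pow]
  push_cast [hle]
  ring

end Observation

/-! ### Converse for an instance in general position -/

section Chain

variable {F : Type} [Field F] {d : ℕ}

/-- The running subspace obtained from a sequence of subspaces of dimension `u` by adding the next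
one as long as the expected dimension does not exceed `d`, and intersecting with it otherwise. -/
def chain (u : ℕ) (U : ℕ → Submodule F (Fin d → F)) : ℕ → Submodule F (Fin d → F)
  | 0 => ⊥
  | j + 1 => if Module.finrank F (chain u U j) + u ≤ d then chain u U j ⊔ U j
      else chain u U j ⊓ U j

theorem chain_congr (u : ℕ) {U U' : ℕ → Submodule F (Fin d → F)} {j : ℕ}
    (h : ∀ i < j, U i = U' i) : chain u U j = chain u U' j := by
  induction j with
  | zero => rfl
  | succ j ih =>
    rw [chain, chain, ih fun i hi => h i (by omega), h j (by omega)]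

/-- The first `k` members of the sequence are in general position, as seen by `chain`. -/
def IsGeneric (u : ℕ) (U : ℕ → Submodule F (Fin d → F)) (k : ℕ) : Prop :=
  ∀ i < k, Module.finrank F (U i) = u ∧
    Module.finrank F ↥(chain u U i ⊔ U i) = min d (Module.finrank F (chain u U i) + u)

theorem mul_le_of_isGeneric {f : Submodule F (Fin d → F) → ℝ}
    (hf : ∀ A B, f A + f B ≤ f (A ⊔ B) + f (A ⊓ B)) (hle : ∀ A, f A ≤ f ⊤) (hbot : f ⊥ = 0)
    {U : ℕ → Submodule F (Fin d → F)} {u k c : ℕ} {μ : ℝ} (hU : IsGeneric u U k)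
    (hμ : ∀ i < k, μ ≤ f (U i)) (hc : k * u ≤ c * d) : k * μ ≤ c * f ⊤ := by
  -- `a` counts how often the running sum has filled the whole space; each time pays one `f ⊤` and
  -- uses up `d` dimensions.
  have key : ∀ j ≤ k, ∃ a : ℕ, j * u = a * d + Module.finrank F (chain u U j) ∧
      j * μ ≤ a * f ⊤ + f (chain u U j) := by
    intro j
    induction j with
    | zero => exact fun _ => ⟨0, by rw [chain, finrank_bot]; simp, by simp [chain, hbot]⟩
    | succ j ih =>
      intro hj
      obtain ⟨a, ha, hb⟩ := ih (by omega)
      obtain ⟨h1, h2⟩ := hU j (by omega)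
      have h3 := Submodule.finrank_sup_add_finrank_inf_eq (chain u U j) (U j)
      have h4 := hμ j (by omega)
      have h5 := hf (chain u U j) (U j)
      by_cases hd : Module.finrank F (chain u U j) + u ≤ d
      · rw [min_eq_right hd] at h2
        have h6 : chain u U j ⊓ U j = ⊥ := Submodule.finrank_eq_zero.1 (by omega)
        rw [h6, hbot] at h5
        refine ⟨a, ?_, ?_⟩
        · rw [chain, if_pos hd, h2, add_mul, ha]; ring
        · rw [chain, if_pos hd]; push_cast; linarith
      · rw [min_eq_left (by omega)] at h2
        have h6 : chain u U j ⊔ U j = ⊤ := Submodule.eq_top_of_finrank_eq (by simpa using h2)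
        rw [h6] at h5
        refine ⟨a + 1, ?_, ?_⟩
        · rw [chain, if_neg hd, add_mul, add_mul, ha]; omega
        · rw [chain, if_neg hd]; push_cast; linarith
  obtain ⟨a, ha, hb⟩ := key k le_rfl
  have h0 : 0 ≤ f ⊤ := hbot ▸ hle ⊥
  have hac : a * d ≤ c * d := by omega
  -- If `a < c`, the leftover `f (chain u U k)` is absorbed by one more `f ⊤`. Otherwise the
  -- dimension count forces the leftover subspace to vanish.
  have hlt : a < c → (k * μ ≤ c * f ⊤) := by
    intro h
    have : ((a : ℝ) + 1) ≤ c := by exact_mod_cast h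
    nlinarith [hle (chain u U k)]
  by_cases h : a < c
  · exact hlt h
  · have h1 : c * d ≤ a * d := Nat.mul_le_mul_right d (by omega)
    have h2 : chain u U k = ⊥ := Submodule.finrank_eq_zero.1 (by omega)
    rw [h2, hbot, add_zero] at hb
    rcases Nat.eq_zero_or_pos d with hd | hd
    · subst hd
      have : f ⊤ = 0 := by rw [Subsingleton.elim (⊤ : Submodule F (Fin 0 → F)) ⊥, hbot]
      simpa [this] using hb
    · have : a = c := le_antisymm (Nat.le_of_mul_le_mul_right hac hd) (by omega)
      rwa [this] at hb

end Chain

section Columns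

variable {F : Type} {K d m m' : ℕ}

/-- All columns, demands and side information, of user `k`. -/
def Inst.cols (I : Inst F K d m m') (k : Fin K) : Fin (m + m') → Fin d → F :=
  Fin.append (I.demand k).transpose (I.side k).transpose

theorem Inst.cols_castAdd (I : Inst F K d m m') (k : Fin K) (i : Fin m) :
    I.cols k (Fin.castAdd m' i) = (I.demand k).transpose i := Fin.append_left _ _ _

theorem Inst.cols_natAdd (I : Inst F K d m m') (k : Fin K) (i : Fin m') :
    I.cols k (Fin.natAdd m i) = (I.side k).transpose i := Fin.append_right _ _ _

end Columns

/-! ### Mutual information between the broadcast symbol and linear observations -/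

section Info

theorem card_matrix_log {F : Type*} [Fintype F] (d L : ℕ) : Real.log (Fintype.card (Matrix (Fin d) (Fin L) F)) =
    L * d * Real.log (Fintype.card F) := by
  have : Fintype.card (Matrix (Fin d) (Fin L) F) = Fintype.card F ^ (d * L) := by
    classical
    rw [← Nat.card_eq_fintype_card, Matrix, Nat.card_pi]
    simp [← pow_mul, mul_comm]
  rw [this]
  push_cast
  rw [Real.log_pow]
  push_cast
  ring

variable {F : Type} [Field F] {K d m m' : ℕ}

/-- The span of all columns of user `k`. -/
def Inst.userSpan (I : Inst F K d m m') (k : Fin K) : Submodule F (Fin d → F) :=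
  Submodule.span F (Set.range (I.cols k))

/-- The span of the side information of user `k`. -/
def Inst.sideSpan (I : Inst F K d m m') (k : Fin K) : Submodule F (Fin d → F) :=
  Submodule.span F (Set.range (I.side k).transpose)

theorem Inst.sideSpan_le (I : Inst F K d m m') (k : Fin K) : I.sideSpan k ≤ I.userSpan k := by
  refine Submodule.span_mono ?_
  rintro _ ⟨i, rfl⟩
  exact ⟨Fin.natAdd m i, I.cols_natAdd k i⟩

theorem transpose_mul_eq_iff {L r : ℕ} (x y : Matrix (Fin d) (Fin L) F)
    (M : Matrix (Fin d) (Fin r) F) : x.transpose * M = y.transpose * M ↔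
      ∀ i, x.transpose.mulVec (M.transpose i) = y.transpose.mulVec (M.transpose i) := by
  constructor
  · intro h i
    ext l
    exact congrFun (congrFun h l) i
  · intro h
    ext l i
    exact congrFun (h i) l

theorem Scheme.obs_userSpan {I : Inst F K d m m'} (s : Scheme I) (k : Fin K)
    {x y : Matrix (Fin d) (Fin s.L) F} (h : s.encode x = s.encode y)
    (hs : obs s.L (I.sideSpan k) x y) : obs s.L (I.userSpan k) x y := by
  have hs' : x.transpose * I.side k = y.transpose * I.side k :=
    (transpose_mul_eq_iff x y _).2 ((obs_span_iff _ x y).1 hs)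
  have hd : x.transpose * I.demand k = y.transpose * I.demand k := by
    rw [← s.correct k x, ← s.correct k y, h, hs']
  refine (obs_span_iff _ x y).2 fun i => ?_
  induction i using Fin.addCases with
  | left i => rw [I.cols_castAdd]; exact (transpose_mul_eq_iff x y _).1 hd i
  | right i => rw [I.cols_natAdd]; exact (transpose_mul_eq_iff x y _).1 hs' i

variable [Fintype F]

/-- The mutual information between the broadcast symbol and the combinations of the data with
coefficient vectors in `W` (times the number of data realizations). -/
def Scheme.info {I : Inst F K d m m'} (s : Scheme I) (W : Submodule F (Fin d → F)) : ℝ :=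
  logClass (Setoid.ker s.encode ⊓ obs s.L W) + Fintype.card (Matrix (Fin d) (Fin s.L) F) *
    (s.L * Module.finrank F W * Real.log (Fintype.card F)) - logClass (Setoid.ker s.encode)

variable {I : Inst F K d m m'} (s : Scheme I)

theorem Scheme.info_bot : s.info ⊥ = 0 := by
  simp [Scheme.info, obs_bot]

/-- The dimension term is modular in `W`, so this is submodularity of entropy applied to the data
given the broadcast symbol and the observations. -/
theorem Scheme.info_supermodular (A B : Submodule F (Fin d → F)) :
    s.info A + s.info B ≤ s.info (A ⊔ B) + s.info (A ⊓ B) := by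
  have h := logClass_add_le (a := Setoid.ker s.encode ⊓ obs s.L A)
    (b := Setoid.ker s.encode ⊓ obs s.L B) (c := Setoid.ker s.encode ⊓ obs s.L (A ⊓ B))
    (inf_le_inf_left _ (obs_anti inf_le_left)) (inf_le_inf_left _ (obs_anti inf_le_right))
  rw [← inf_inf_distrib_left, ← obs_sup] at h
  have h2 : (Module.finrank F ↥(A ⊔ B) : ℝ) + Module.finrank F ↥(A ⊓ B) =
      Module.finrank F A + Module.finrank F B := by
    exact_mod_cast Submodule.finrank_sup_add_finrank_inf_eq A B
  have h3 : ((Fintype.card (Matrix (Fin d) (Fin s.L) F) : ℝ) * s.L * Real.log (Fintype.card F)) *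
      ((Module.finrank F ↥(A ⊔ B) : ℝ) + Module.finrank F ↥(A ⊓ B)) =
      ((Fintype.card (Matrix (Fin d) (Fin s.L) F) : ℝ) * s.L * Real.log (Fintype.card F)) *
      (Module.finrank F A + Module.finrank F B) := by rw [h2]
  unfold Scheme.info
  linarith

theorem Scheme.info_top : s.info ⊤ = Fintype.card (Matrix (Fin d) (Fin s.L) F) *
    (s.L * d * Real.log (Fintype.card F)) - logClass (Setoid.ker s.encode) := by
  simp [Scheme.info, obs_top, logClass_bot]

theorem Scheme.info_le_top (W : Submodule F (Fin d → F)) : s.info W ≤ s.info ⊤ := by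
  classical
  have h := logClass_mono (inf_le_right : Setoid.ker s.encode ⊓ obs s.L W ≤ _)
  rw [logClass_obs] at h
  rw [s.info_top]
  unfold Scheme.info
  linarith

theorem Scheme.info_nonneg (W : Submodule F (Fin d → F)) : 0 ≤ s.info W := by
  classical
  have h := logClass_add_le (a := Setoid.ker s.encode) (b := obs s.L W) le_top le_top
  rw [logClass_obs, logClass_top, card_matrix_log] at h
  unfold Scheme.info
  linarith

/-- Given the broadcast symbol, observing the side information is the same as observing all columns
of the user. So `info` of the two spans differs only by the dimension term, and `info` of the side
span is nonnegative. -/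
theorem Scheme.le_info_userSpan (k : Fin K) : Fintype.card (Matrix (Fin d) (Fin s.L) F) *
    (s.L * ((Module.finrank F (I.userSpan k) : ℝ) - m') * Real.log (Fintype.card F)) ≤
      s.info (I.userSpan k) := by
  have h1 : Setoid.ker s.encode ⊓ obs s.L (I.userSpan k) =
      Setoid.ker s.encode ⊓ obs s.L (I.sideSpan k) := by
    refine le_antisymm (inf_le_inf_left _ (obs_anti (I.sideSpan_le k))) ?_
    rintro x y ⟨h, h'⟩
    exact ⟨h, s.obs_userSpan k h h'⟩
  have h2 := s.info_nonneg (I.sideSpan k)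
  have h3 : (Module.finrank F (I.sideSpan k) : ℝ) ≤ m' := by
    have := finrank_range_le_card (R := F) (I.side k).transpose
    rw [Fintype.card_fin] at this
    exact_mod_cast this
  have hq : 0 ≤ Real.log (Fintype.card F) := Real.log_natCast_nonneg _
  have h4 : 0 ≤ ((Fintype.card (Matrix (Fin d) (Fin s.L) F) : ℝ) * s.L *
      Real.log (Fintype.card F)) * (m' - Module.finrank F (I.sideSpan k)) :=
    mul_nonneg (by positivity) (by linarith)
  unfold Scheme.info at h2 ⊢
  rw [h1]
  linarith

theorem Scheme.info_top_le : s.info ⊤ ≤ Fintype.card (Matrix (Fin d) (Fin s.L) F) *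
    (s.L * Real.log (Fintype.card F) * s.cost) := by
  have := s.fintypeAlphabet
  have h := card_mul_log_sub_le s.encode
  have hq : 0 < Real.log (Fintype.card F) :=
    Real.log_pos (by exact_mod_cast Fintype.one_lt_card)
  have hL : (0 : ℝ) < s.L := by exact_mod_cast s.L_pos
  have hc : s.L * Real.log (Fintype.card F) * s.cost = Real.log (Fintype.card s.Alphabet) := by
    rw [Scheme.cost, Real.logb, Nat.card_eq_fintype_card, Nat.card_eq_fintype_card]
    field_simp
  rw [s.info_top, hc]
  rw [card_matrix_log] at h
  linarith

/-- A lower bound for the cost from users in general position. -/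
theorem Scheme.mul_le_mul_cost {U : ℕ → Submodule F (Fin d → F)} {k c u : ℕ}
    (hU : IsGeneric u U k) (hI : ∀ i < k, ∃ j, U i = I.userSpan j) (hc : k * u ≤ c * d) :
    k * ((u : ℝ) - m') ≤ c * s.cost := by
  have hq : 0 < Real.log (Fintype.card F) :=
    Real.log_pos (by exact_mod_cast Fintype.one_lt_card)
  have hL : (0 : ℝ) < s.L := by exact_mod_cast s.L_pos
  have hN : (0 : ℝ) < Fintype.card (Matrix (Fin d) (Fin s.L) F) := by
    exact_mod_cast Fintype.card_pos
  have h := mul_le_of_isGeneric s.info_supermodular s.info_le_top s.info_bot hU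
    (μ := Fintype.card (Matrix (Fin d) (Fin s.L) F) *
      (s.L * ((u : ℝ) - m') * Real.log (Fintype.card F))) (fun i hi => by
        obtain ⟨j, hj⟩ := hI i hi
        rw [← (hU i hi).1, hj]
        exact s.le_info_userSpan j) hc
  have h2 := mul_le_mul_of_nonneg_left s.info_top_le (Nat.cast_nonneg (α := ℝ) c)
  have h3 : 0 < (Fintype.card (Matrix (Fin d) (Fin s.L) F) : ℝ) * s.L *
    Real.log (Fintype.card F) := by positivity
  refine le_of_mul_le_mul_left ?_ h3
  linarith

theorem Scheme.finrank_userSpan_sub_le_cost (k : Fin K) :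
    (Module.finrank F (I.userSpan k) : ℝ) - m' ≤ s.cost := by
  have hq : 0 < Real.log (Fintype.card F) :=
    Real.log_pos (by exact_mod_cast Fintype.one_lt_card)
  have hL : (0 : ℝ) < s.L := by exact_mod_cast s.L_pos
  have hN : (0 : ℝ) < Fintype.card (Matrix (Fin d) (Fin s.L) F) := by
    exact_mod_cast Fintype.card_pos
  have h := ((s.le_info_userSpan k).trans (s.info_le_top _)).trans s.info_top_le
  have h3 : 0 < (Fintype.card (Matrix (Fin d) (Fin s.L) F) : ℝ) * s.L *
    Real.log (Fintype.card F) := by positivity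
  refine le_of_mul_le_mul_left ?_ h3
  linarith

end Info

/-! ### Bounding the optimal cost by schemes -/

section OptCost

variable {F : Type} [Field F] {K d m m' : ℕ}

open Classical in
/-- A scheme from an encoder that, together with the side information, determines the demands. -/
def Scheme.ofEncode {I : Inst F K d m m'} (L : ℕ) (hL : 0 < L) (S : Type) [Fintype S]
    (Φ : Matrix (Fin d) (Fin L) F → S)
    (h : ∀ k x y, Φ x = Φ y → x.transpose * I.side k = y.transpose * I.side k →
      x.transpose * I.demand k = y.transpose * I.demand k) : Scheme I where
  L := L
  L_pos := hL
  Alphabet := S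
  fintypeAlphabet := inferInstance
  encode := Φ
  decode k a y := if hx : ∃ x, Φ x = a ∧ x.transpose * I.side k = y then
    hx.choose.transpose * I.demand k else 0
  correct k x := by
    have hx : ∃ x', Φ x' = Φ x ∧ x'.transpose * I.side k = x.transpose * I.side k := ⟨x, rfl, rfl⟩
    rw [dif_pos hx]
    exact h k _ _ hx.choose_spec.1 hx.choose_spec.2

theorem Scheme.cost_nonneg [Finite F] {I : Inst F K d m m'} (s : Scheme I) : 0 ≤ s.cost := by
  have := Fintype.ofFinite F
  have := s.fintypeAlphabet
  have hne : Nonempty s.Alphabet := ⟨s.encode 0⟩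
  refine div_nonneg (Real.logb_nonneg ?_ ?_) (Nat.cast_nonneg _)
  · exact_mod_cast Finite.one_lt_card
  · exact_mod_cast Nat.card_pos

theorem optCost_le [Finite F] {I : Inst F K d m m'} (s : Scheme I) : optCost I ≤ s.cost :=
  csInf_le ⟨0, by rintro _ ⟨s, rfl⟩; exact s.cost_nonneg⟩ ⟨s, rfl⟩

theorem le_optCost [Finite F] {I : Inst F K d m m'} {b : ℝ} (h : ∀ s : Scheme I, b ≤ s.cost) :
    b ≤ optCost I := by
  have := Fintype.ofFinite F
  classical
  refine le_csInf ?_ (by rintro _ ⟨s, rfl⟩; exact h s)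
  -- The infimum needs a nonempty set: broadcasting the data uncoded always works.
  have : Fintype (Matrix (Fin d) (Fin 1) F) := Fintype.ofFinite _
  exact ⟨_, Scheme.ofEncode 1 one_pos (Matrix (Fin d) (Fin 1) F) id
    (fun k x y hxy _ => by rw [show x = y from hxy]), rfl⟩

end OptCost

/-! ### Probability on finite types -/

section Prob

theorem prob_nonneg (α : Type) (P : α → Prop) : 0 ≤ prob α P := by
  unfold prob; positivity

theorem prob_mono {α : Type} [Finite α] {P Q : α → Prop} (h : ∀ a, P a → Q a) :
    prob α P ≤ prob α Q := by
  unfold prob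
  gcongr
  exact Nat.card_mono (Set.toFinite {a | Q a}) h

theorem prob_add_prob_not {α : Type} [Finite α] [Nonempty α] (P : α → Prop) :
    prob α P + prob α (fun a => ¬ P a) = 1 := by
  classical
  have := Fintype.ofFinite α
  have h := Fintype.card_subtype_compl P
  have h' := Fintype.card_subtype_le P
  have hpos : (0 : ℝ) < Fintype.card α := by exact_mod_cast Fintype.card_pos
  unfold prob
  simp only [Nat.card_eq_fintype_card]
  rw [← add_div, div_eq_one_iff_eq hpos.ne', h]
  push_cast [h']
  ring

theorem prob_exists_le {α : Type} [Finite α] {ι : Type*} [Fintype ι] (P : ι → α → Prop) :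
    prob α (fun a => ∃ i, P i a) ≤ ∑ i, prob α (P i) := by
  classical
  have := Fintype.ofFinite α
  unfold prob
  rw [← Finset.sum_div]
  gcongr
  norm_cast
  simp only [Nat.card_eq_fintype_card, Fintype.card_subtype]
  refine le_trans (Finset.card_le_card ?_) Finset.card_biUnion_le
  intro a
  simp

/-- Conditioning by resampling: the uniform distribution is translation invariant, so averaging over
the shifts `e w` changes nothing. It allows one block of an instance to be randomized with the rest
fixed, without product decompositions. -/
theorem prob_le_of_translate {V W : Type} [AddGroup V] [Finite V] [Finite W] [Nonempty W]
    (e : W → V) {P : V → Prop} {δ : ℝ} (h : ∀ x, prob W (fun w => P (x + e w)) ≤ δ) :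
    prob V P ≤ δ := by
  classical
  have := Fintype.ofFinite V
  have := Fintype.ofFinite W
  have hW : (0 : ℝ) < Fintype.card W := by exact_mod_cast Fintype.card_pos
  have hV : (0 : ℝ) < Fintype.card V := by exact_mod_cast Fintype.card_pos
  have hc : ∀ (α : Type) [Fintype α] (Q : α → Prop),
      (Nat.card {a // Q a} : ℝ) = ∑ a, if Q a then (1 : ℝ) else 0 := by
    intro α _ Q
    rw [Finset.sum_boole, Nat.card_eq_fintype_card, Fintype.card_subtype]
  have h1 : ∀ w : W, (Nat.card {x // P x} : ℝ) = ∑ x, if P (x + e w) then (1 : ℝ) else 0 := by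
    intro w
    rw [hc]
    exact (Equiv.sum_comp (Equiv.addRight (e w)) fun x => if P x then (1 : ℝ) else 0).symm
  have h2 : (Fintype.card W : ℝ) * Nat.card {x // P x} =
      ∑ x : V, (Nat.card {w : W // P (x + e w)} : ℝ) := by
    simp only [hc W]
    rw [Finset.sum_comm]
    simp only [← h1]
    simp
  have h3 : ∀ x : V, (Nat.card {w : W // P (x + e w)} : ℝ) ≤ δ * Fintype.card W := by
    intro x
    have := h x
    rw [prob, div_le_iff₀ (by rwa [Nat.card_eq_fintype_card]), Nat.card_eq_fintype_card (α := W)]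
      at this
    exact this
  have h4 := Finset.sum_le_sum fun x (_ : x ∈ Finset.univ) => h3 x
  rw [← h2, Finset.sum_const, nsmul_eq_mul, Finset.card_univ] at h4
  rw [prob, Nat.card_eq_fintype_card (α := V), div_le_iff₀ hV]
  refine le_of_mul_le_mul_left ?_ hW
  linarith

end Prob

/-! ### Random subspaces -/

section RandomSubspace

variable {F : Type} [Field F] {d : ℕ}

theorem finrank_sup_span_image_lt (A : Submodule F (Fin d → F)) {u : ℕ}
    (w : Fin u → Fin d → F)
    (h : ∀ i, A ⊔ Submodule.span F (w '' {i' | i'.val < i.val}) = ⊤ ∨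
      w i ∉ A ⊔ Submodule.span F (w '' {i' | i'.val < i.val})) (j : ℕ) (hj : j ≤ u) :
    Module.finrank F ↥(A ⊔ Submodule.span F (w '' {i' | i'.val < j})) =
      min d (Module.finrank F A + j) := by
  induction j with
  | zero =>
    have : Module.finrank F A ≤ d := by simpa using A.finrank_le
    rw [show {i' : Fin u | i'.val < 0} = ∅ by ext i; simp, Set.image_empty, Submodule.span_empty,
      sup_bot_eq, add_zero, min_eq_right this]
  | succ j ih =>
    have hset : {i' : Fin u | i'.val < j + 1} = insert ⟨j, hj⟩ {i' | i'.val < j} := by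
      ext i; simp [Fin.ext_iff]; omega
    rw [hset, Set.image_insert_eq, Submodule.span_insert, sup_comm (Submodule.span F {_}),
      ← sup_assoc]
    have h0 := ih (by omega)
    rcases h ⟨j, hj⟩ with h1 | h1
    · simp only at h1
      rw [h1] at h0
      rw [h1, top_sup_eq]
      simp only [finrank_top, Module.finrank_fintype_fun_eq_card, Fintype.card_fin] at h0 ⊢
      omega
    · simp only at h1
      set B := A ⊔ Submodule.span F (w '' {i' | i'.val < j}) with hB
      have hlt : B < B ⊔ Submodule.span F {w ⟨j, hj⟩} := by
        refine lt_of_le_of_ne le_sup_left fun h2 => h1 ?_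
        rw [h2]
        exact le_sup_right (a := B) (Submodule.mem_span_singleton_self _)
      have h2 := Submodule.finrank_lt_finrank_of_lt hlt
      have h3 := Submodule.finrank_add_le_finrank_add_finrank B (Submodule.span F {w ⟨j, hj⟩})
      have h4 : Module.finrank F (Submodule.span F {w ⟨j, hj⟩}) ≤ 1 := by
        simpa using finrank_span_le_card (R := F) ({w ⟨j, hj⟩} : Set (Fin d → F))
      have h5 : Module.finrank F ↥(B ⊔ Submodule.span F {w ⟨j, hj⟩}) ≤ d := by
        simpa using (B ⊔ Submodule.span F {w ⟨j, hj⟩}).finrank_le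
      omega

variable [Finite F]

theorem prob_add_mem_le {B : Submodule F (Fin d → F)} (hB : B ≠ ⊤) (x₀ : Fin d → F) :
    prob (Fin d → F) (fun x => x₀ + x ∈ B) ≤ 1 / Nat.card F := by
  have e : {x : Fin d → F // x₀ + x ∈ B} ≃ B :=
    (Equiv.addLeft x₀).subtypeEquiv fun x => by simp
  have hq : (0 : ℝ) < Nat.card F := by exact_mod_cast Nat.card_pos
  have h1 : Module.finrank F B + 1 ≤ d := by
    simpa using Submodule.finrank_lt hB
  have h2 : Nat.card B * Nat.card F ≤ Nat.card (Fin d → F) := by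
    rw [Module.natCard_eq_pow_finrank (K := F) (V := B), ← pow_succ,
      Module.natCard_eq_pow_finrank (K := F) (V := Fin d → F)]
    refine Nat.pow_le_pow_right Nat.card_pos ?_
    simpa using h1
  have hV : (0 : ℝ) < Nat.card (Fin d → F) := by exact_mod_cast Nat.card_pos
  rw [prob, Nat.card_congr e, div_le_div_iff₀ hV hq, one_mul]
  exact_mod_cast h2

/-- The dimension is as expected unless some vector falls into a proper subspace spanned by `A` and
the earlier vectors. Resampling that vector alone bounds each such event by `1 / |F|`. -/
theorem prob_finrank_sup_span_ne (A : Submodule F (Fin d → F)) (u : ℕ) :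
    prob (Fin u → Fin d → F) (fun w => Module.finrank F ↥(A ⊔ Submodule.span F (Set.range w)) ≠
      min d (Module.finrank F A + u)) ≤ u / Nat.card F := by
  let bad : Fin u → (Fin u → Fin d → F) → Prop := fun i w =>
    A ⊔ Submodule.span F (w '' {i' | i'.val < i.val}) ≠ ⊤ ∧
      w i ∈ A ⊔ Submodule.span F (w '' {i' | i'.val < i.val})
  have h1 : ∀ i, prob (Fin u → Fin d → F) (bad i) ≤ 1 / Nat.card F := by
    intro i
    refine prob_le_of_translate (W := Fin d → F) (fun x => Pi.single i x) fun w => ?_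
    have himg : ∀ x : Fin d → F, (w + Pi.single i x) '' {i' | i'.val < i.val} =
        w '' {i' | i'.val < i.val} := by
      intro x
      refine Set.image_congr fun i' hi' => ?_
      have : i' ≠ i := fun h => by simp [h] at hi'
      simp [this]
    have hbad : ∀ x : Fin d → F, bad i (w + Pi.single i x) ↔
        A ⊔ Submodule.span F (w '' {i' | i'.val < i.val}) ≠ ⊤ ∧
          w i + x ∈ A ⊔ Submodule.span F (w '' {i' | i'.val < i.val}) := by
      intro x
      simp only [bad]
      rw [himg, Pi.add_apply, Pi.single_eq_same]
    simp only [hbad]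
    by_cases hB : A ⊔ Submodule.span F (w '' {i' | i'.val < i.val}) = ⊤
    · simp only [hB, ne_eq, not_true_eq_false, false_and]
      simp [prob]
    · exact (prob_mono fun x hx => hx.2).trans (prob_add_mem_le hB (w i))
  calc _ ≤ prob (Fin u → Fin d → F) (fun w => ∃ i, bad i w) := by
        refine prob_mono fun w hw => ?_
        by_contra! hcon
        refine hw ?_
        have := finrank_sup_span_image_lt A w (fun i => ?_) u le_rfl
        · rwa [show {i' : Fin u | i'.val < u} = Set.univ by ext i; simp, Set.image_univ] at this
        · by_contra! h
          exact hcon i h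
    _ ≤ ∑ i : Fin u, prob (Fin u → Fin d → F) (bad i) := prob_exists_le _
    _ ≤ ∑ i : Fin u, 1 / (Nat.card F : ℝ) := Finset.sum_le_sum fun i _ => h1 i
    _ = u / Nat.card F := by simp [div_eq_mul_inv]

/-- A random subspace that is independent of `A` is in general position to `A`. -/
theorem prob_finrank_sup_span_ne_of_translate {X : Type} [AddGroup X] [Finite X] {r : ℕ}
    (e : (Fin r → Fin d → F) → X) (g : X → Fin r → Fin d → F)
    (A : X → Submodule F (Fin d → F)) (hg : ∀ x w, g (x + e w) = g x + w)
    (hA : ∀ x w, A (x + e w) = A x) :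
    prob X (fun x => Module.finrank F ↥(A x ⊔ Submodule.span F (Set.range (g x))) ≠
      min d (Module.finrank F (A x) + r)) ≤ r / Nat.card F := by
  refine prob_le_of_translate e fun x => ?_
  have h : ∀ w, (Module.finrank F ↥(A (x + e w) ⊔ Submodule.span F (Set.range (g (x + e w)))) ≠
      min d (Module.finrank F (A (x + e w)) + r)) ↔
      (Module.finrank F ↥(A x ⊔ Submodule.span F (Set.range (g x + w))) ≠
      min d (Module.finrank F (A x) + r)) := fun w => by rw [hg, hA]
  have key := prob_finrank_sup_span_ne (A x) r
  unfold prob at key ⊢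
  refine le_of_eq_of_le ?_ key
  congr 2
  exact Nat.card_congr ((Equiv.addLeft (g x)).subtypeEquiv h)

end RandomSubspace

/-! ### Properties of almost all instances -/

section Generically

/-- The property `P` holds with probability tending to `1`. -/
def Generically (p : ℕ) [Fact p.Prime] (K d m m' : ℕ)
    (P : ∀ n, Inst (GaloisField p n) K d m m' → Prop) : Prop :=
  Tendsto (fun n => prob (Inst (GaloisField p n) K d m m') (P n)) atTop (𝓝 1)

variable {p : ℕ} [Fact p.Prime] {K d m m' : ℕ}
  {P Q : ∀ n, Inst (GaloisField p n) K d m m' → Prop}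

theorem generically_iff : Generically p K d m m' P ↔
    Tendsto (fun n => prob (Inst (GaloisField p n) K d m m') fun I => ¬ P n I) atTop (𝓝 0) := by
  have h : ∀ n, prob (Inst (GaloisField p n) K d m m') (P n) =
      1 - prob (Inst (GaloisField p n) K d m m') fun I => ¬ P n I := fun n => by
    rw [← prob_add_prob_not (P n)]; ring
  unfold Generically
  constructor
  · intro hP
    have := hP.const_sub 1
    simpa [h] using this
  · intro hP
    have := hP.const_sub 1
    simpa [h] using this

theorem generically_of_le {b : ℕ → ℝ} (hb : Tendsto b atTop (𝓝 0))
    (h : ∀ᶠ n in atTop, prob (Inst (GaloisField p n) K d m m') (fun I => ¬ P n I) ≤ b n) :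
    Generically p K d m m' P :=
  generically_iff.2 (squeeze_zero' (Eventually.of_forall fun _ => prob_nonneg _ _) h hb)

theorem Generically.mono (hP : Generically p K d m m' P)
    (h : ∀ᶠ n in atTop, ∀ I, P n I → Q n I) : Generically p K d m m' Q := by
  refine generically_of_le (generically_iff.1 hP) ?_
  filter_upwards [h] with n hn
  exact prob_mono fun I hI hP' => hI (hn I hP')

theorem Generically.forall {ι : Type*} [Fintype ι]
    {P : ι → ∀ n, Inst (GaloisField p n) K d m m' → Prop}
    (h : ∀ i, Generically p K d m m' (P i)) : Generically p K d m m' fun n I => ∀ i, P i n I := by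
  refine generically_of_le (b := fun n => ∑ i, prob _ fun I => ¬ P i n I) ?_ ?_
  · rw [← Finset.sum_const_zero (s := (Finset.univ : Finset ι))]
    exact tendsto_finsetSum _ fun i _ => generically_iff.1 (h i)
  · refine Eventually.of_forall fun n => le_trans (prob_mono ?_) (prob_exists_le _)
    intro I hI
    by_contra! h
    exact hI h

theorem Generically.and (hP : Generically p K d m m' P) (hQ : Generically p K d m m' Q) :
    Generically p K d m m' fun n I => P n I ∧ Q n I := by
  have := Generically.forall (ι := Bool) (P := fun b => if b then P else Q) fun b => by
    cases b <;> simpa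
  exact this.mono (Eventually.of_forall fun n I h => ⟨h true, h false⟩)

theorem Generically.exists (hP : Generically p K d m m' P) : ∀ᶠ n in atTop, ∃ I, P n I := by
  filter_upwards [hP.eventually (lt_mem_nhds (zero_lt_one' ℝ))] with n hn
  by_contra! h
  simp [prob, h] at hn

theorem tendsto_div_card (p : ℕ) [Fact p.Prime] (C : ℝ) :
    Tendsto (fun n => C / (Nat.card (GaloisField p n) : ℝ)) atTop (𝓝 0) := by
  have hp : (1 : ℝ) < p := by exact_mod_cast (Fact.out : p.Prime).one_lt
  have h := (tendsto_pow_atTop_atTop_of_one_lt hp).const_div_atTop C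
  refine h.congr' ?_
  filter_upwards [eventually_ne_atTop 0] with n hn
  rw [GaloisField.card p n hn]
  push_cast
  rfl

/-- A lower bound for the generic cost from a generic lower bound for the cost. -/
theorem IsGenericCost.le_of_generically {Δ b : ℝ} (hΔ : IsGenericCost p K d m m' Δ)
    (hb : Generically p K d m m' fun _ I => b ≤ optCost I) : b ≤ Δ := by
  refine le_of_forall_pos_lt_add fun ε hε => ?_
  obtain ⟨n, I, h1, h2⟩ := (Generically.and (hΔ ε hε) hb).exists.exists
  have := (abs_lt.1 h1).2
  linarith

end Generically

/-! ### Generic position of the users -/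

section Columns

variable {F : Type} [Field F] {K d m m' : ℕ}

/-- The instance with columns `w` at user `k`, and zeros elsewhere. -/
def Inst.ofCols (k : Fin K) (w : Fin (m + m') → Fin d → F) : Inst F K d m m' :=
  (Pi.single k (Matrix.of fun r i => w (Fin.castAdd m' i) r),
    Pi.single k (Matrix.of fun r i => w (Fin.natAdd m i) r))

theorem Inst.cols_add_ofCols (I : Inst F K d m m') (k : Fin K) (w : Fin (m + m') → Fin d → F) :
    (I + Inst.ofCols k w).cols k = I.cols k + w := by
  funext i
  rw [Pi.add_apply]
  induction i using Fin.addCases with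
  | left i =>
    rw [Inst.cols_castAdd, Inst.cols_castAdd]
    ext r
    simp [Inst.demand, Inst.ofCols]
  | right i =>
    rw [Inst.cols_natAdd, Inst.cols_natAdd]
    ext r
    simp [Inst.side, Inst.ofCols]

theorem Inst.cols_add_ofCols_of_ne (I : Inst F K d m m') {k k' : Fin K} (h : k' ≠ k)
    (w : Fin (m + m') → Fin d → F) : (I + Inst.ofCols k w).cols k' = I.cols k' := by
  funext i
  induction i using Fin.addCases with
  | left i =>
    rw [Inst.cols_castAdd, Inst.cols_castAdd]
    ext r
    simp [Inst.demand, Inst.ofCols, h]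
  | right i =>
    rw [Inst.cols_natAdd, Inst.cols_natAdd]
    ext r
    simp [Inst.side, Inst.ofCols, h]

theorem Inst.userSpan_add_ofCols_of_ne (I : Inst F K d m m') {k k' : Fin K} (h : k' ≠ k)
    (w : Fin (m + m') → Fin d → F) : (I + Inst.ofCols k w).userSpan k' = I.userSpan k' := by
  rw [Inst.userSpan, I.cols_add_ofCols_of_ne h, Inst.userSpan]

/-- The columns of the side information of user `k`. -/
def Inst.sideCols (I : Inst F K d m m') (k : Fin K) : Fin m' → Fin d → F :=
  (I.side k).transpose

theorem Inst.side_add_ofCols (I : Inst F K d m m') (k : Fin K) (w : Fin m' → Fin d → F) :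
    (I + Inst.ofCols k (Fin.append 0 w)).sideCols k = I.sideCols k + w := by
  ext i r
  rw [Pi.add_apply, Pi.add_apply]
  simp [Inst.sideCols, Inst.side, Inst.ofCols]

/-- The spans of the columns of the users, extended by zero to a sequence. -/
def Inst.userSeq (I : Inst F K d m m') (j : ℕ) : Submodule F (Fin d → F) :=
  if h : j < K then I.userSpan ⟨j, h⟩ else ⊥

variable [Finite F]

theorem prob_finrank_userSpan_ne (k : Fin K) (A : Inst F K d m m' → Submodule F (Fin d → F))
    (hA : ∀ I w, A (I + Inst.ofCols k w) = A I) :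
    prob (Inst F K d m m') (fun I => Module.finrank F ↥(A I ⊔ I.userSpan k) ≠
      min d (Module.finrank F (A I) + (m + m'))) ≤ (m + m' : ℕ) / Nat.card F :=
  prob_finrank_sup_span_ne_of_translate (Inst.ofCols k) (fun I => I.cols k) A
    (fun I w => I.cols_add_ofCols k w) hA

theorem prob_finrank_sideSpan_ne (k : Fin K) (A : Inst F K d m m' → Submodule F (Fin d → F))
    (hA : ∀ I w, A (I + Inst.ofCols k w) = A I) :
    prob (Inst F K d m m') (fun I => Module.finrank F ↥(A I ⊔ I.sideSpan k) ≠
      min d (Module.finrank F (A I) + m')) ≤ m' / Nat.card F :=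
  prob_finrank_sup_span_ne_of_translate (fun w => Inst.ofCols k (Fin.append 0 w))
    (fun I => I.sideCols k) A (fun I w => I.side_add_ofCols k w) fun I _ => hA I _

end Columns

/-! ### Lower bounds for the generic cost -/

section Converse

variable (p : ℕ) [Fact p.Prime] {K d m m' : ℕ}

theorem generically_finrank_userSpan (k : Fin K)
    (A : ∀ n, Inst (GaloisField p n) K d m m' → Submodule (GaloisField p n) (Fin d → _))
    (hA : ∀ n I w, A n (I + Inst.ofCols k w) = A n I) :
    Generically p K d m m' fun n I => Module.finrank (GaloisField p n) ↥(A n I ⊔ I.userSpan k) =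
      min d (Module.finrank (GaloisField p n) (A n I) + (m + m')) :=
  generically_of_le (tendsto_div_card p (m + m' : ℕ)) (Eventually.of_forall fun n =>
    prob_finrank_userSpan_ne k (A n) (hA n))

theorem generically_finrank_sideSpan (k : Fin K)
    (A : ∀ n, Inst (GaloisField p n) K d m m' → Submodule (GaloisField p n) (Fin d → _))
    (hA : ∀ n I w, A n (I + Inst.ofCols k w) = A n I) :
    Generically p K d m m' fun n I => Module.finrank (GaloisField p n) ↥(A n I ⊔ I.sideSpan k) =
      min d (Module.finrank (GaloisField p n) (A n I) + m') :=
  generically_of_le (tendsto_div_card p m') (Eventually.of_forall fun n =>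
    prob_finrank_sideSpan_ne k (A n) (hA n))

theorem generically_finrank_userSpan_eq (k : Fin K) :
    Generically p K d m m' fun n I => Module.finrank (GaloisField p n) (I.userSpan k) =
      min d (m + m') := by
  refine (generically_finrank_userSpan p k (fun n _ => ⊥) fun _ _ _ => rfl).mono
    (Eventually.of_forall fun n I h => ?_)
  rwa [bot_sup_eq, finrank_bot, zero_add] at h

theorem generically_isGeneric (h : m + m' ≤ d) :
    Generically p K d m m' fun _ I => IsGeneric (m + m') I.userSeq K := by
  have h1 := Generically.forall fun k : Fin K => generically_finrank_userSpan_eq p (d := d)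
    (m := m) (m' := m') k
  -- The running subspace before user `k` depends only on earlier users, so it is unchanged when
  -- user `k` is resampled.
  have h2 := Generically.forall fun k : Fin K => generically_finrank_userSpan p (d := d)
    (m := m) (m' := m') k (fun n I => chain (m + m') I.userSeq k) fun n I w => by
      refine chain_congr _ fun i hi => ?_
      unfold Inst.userSeq
      split_ifs with hK
      · exact I.userSpan_add_ofCols_of_ne (fun h => by simp [← h] at hi) w
      · rfl
  refine (h1.and h2).mono (Eventually.of_forall fun n I hI i hi => ?_)
  have e : I.userSeq i = I.userSpan ⟨i, hi⟩ := by rw [Inst.userSeq, dif_pos hi]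
  rw [e]
  exact ⟨(hI.1 ⟨i, hi⟩).trans (min_eq_right h), hI.2 ⟨i, hi⟩⟩

theorem generically_div_le_optCost (h : m + m' ≤ d) {k c : ℕ} (hk : k ≤ K) (hc0 : 0 < c)
    (hc : k * (m + m') ≤ c * d) :
    Generically p K d m m' fun _ I => (k * m / c : ℝ) ≤ optCost I := by
  refine (generically_isGeneric p h).mono (Eventually.of_forall fun n I hI => ?_)
  have := Fintype.ofFinite (GaloisField p n)
  refine le_optCost fun s => ?_
  have h1 := s.mul_le_mul_cost (fun i hi => hI i (hi.trans_le hk)) (fun i hi =>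
    ⟨⟨i, hi.trans_le hk⟩, by rw [Inst.userSeq, dif_pos (hi.trans_le hk)]⟩) hc
  have hc' : (0 : ℝ) < c := by exact_mod_cast hc0
  rw [div_le_iff₀ hc']
  push_cast at h1
  linarith

/-- The converse for users whose columns do not span everything. -/
theorem IsGenericCost.mul_le {Δ : ℝ} (hΔ : IsGenericCost p K d m m' Δ) (h : m + m' ≤ d) {k c : ℕ}
    (hk : k ≤ K) (hc0 : 0 < c) (hc : k * (m + m') ≤ c * d) : (k * m : ℝ) ≤ c * Δ := by
  have h1 := hΔ.le_of_generically (generically_div_le_optCost p h hk hc0 hc)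
  have hc' : (0 : ℝ) < c := by exact_mod_cast hc0
  rwa [div_le_iff₀' hc'] at h1

theorem IsGenericCost.sub_le {Δ : ℝ} (hΔ : IsGenericCost p K d m m' Δ) (hK : 0 < K)
    (h : d ≤ m + m') : (d - m' : ℝ) ≤ Δ := by
  refine hΔ.le_of_generically ?_
  refine (generically_finrank_userSpan_eq p (⟨0, hK⟩ : Fin K)).mono
    (Eventually.of_forall fun n I hI => le_optCost fun s => ?_)
  have := Fintype.ofFinite (GaloisField p n)
  have h1 := s.finrank_userSpan_sub_le_cost ⟨0, hK⟩
  rwa [hI, min_eq_left h] at h1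

end Converse

/-! ### Broadcasting a common vector of all users -/

section CommonVector

theorem userSpan_eq_span_insert {F : Type} [Field F] {K d m' : ℕ} (I : Inst F K d 1 m')
    (k : Fin K) : I.userSpan k =
      Submodule.span F (insert ((I.demand k).transpose 0) (Set.range (I.side k).transpose)) := by
  refine congrArg (Submodule.span F) (Set.ext fun x => ?_)
  constructor
  · rintro ⟨i, rfl⟩
    induction i using Fin.addCases with
    | left i => rw [Inst.cols_castAdd, Subsingleton.elim i 0]; exact Set.mem_insert _ _
    | right i => rw [Inst.cols_natAdd]; exact Set.mem_insert_of_mem _ ⟨i, rfl⟩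
  · rintro (rfl | ⟨i, rfl⟩)
    · exact ⟨Fin.castAdd m' 0, I.cols_castAdd k 0⟩
    · exact ⟨Fin.natAdd 1 i, I.cols_natAdd k i⟩

/-- One field symbol `xᵀ w` is sent. By the exchange property each user's demand lies in the span of
`w` and its side information. -/
theorem optCost_le_one_of_common {F : Type} [Field F] [Finite F] {K d m' : ℕ}
    (I : Inst F K d 1 m') (w : Fin d → F) (hw : ∀ k, w ∈ I.userSpan k)
    (hw' : ∀ k, w ∉ I.sideSpan k) : optCost I ≤ 1 := by
  have := Fintype.ofFinite F
  let s : Scheme I := Scheme.ofEncode 1 one_pos F (fun x => x.transpose.mulVec w 0) (by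
    intro k x y hxy hside
    have h1 : (I.demand k).transpose 0 ∈
        Submodule.span F (insert w (Set.range (I.side k).transpose)) :=
      mem_span_insert_exchange (userSpan_eq_span_insert I k ▸ hw k) (hw' k)
    rw [Submodule.span_insert] at h1
    have h2 : obs 1 (Submodule.span F {w} ⊔ Submodule.span F (Set.range (I.side k).transpose))
        x y := by
      rw [obs_sup]
      refine ⟨?_, (obs_span_iff _ x y).2 ((transpose_mul_eq_iff x y _).1 hside)⟩
      intro z hz
      obtain ⟨c, rfl⟩ := Submodule.mem_span_singleton.1 hz
      rw [Matrix.mulVec_smul, Matrix.mulVec_smul]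
      congr 1
      funext l
      rw [Subsingleton.elim l 0]
      exact hxy
    refine (transpose_mul_eq_iff x y _).2 fun i => ?_
    rw [Subsingleton.elim i 0]
    exact h2 _ h1)
  refine (optCost_le s).trans (le_of_eq ?_)
  have hq : (1 : ℝ) < Nat.card F := by exact_mod_cast Finite.one_lt_card
  change Real.logb (Nat.card F) (Nat.card F) / ((1 : ℕ) : ℝ) = 1
  rw [Real.logb_self_eq_one hq]
  simp

variable (p : ℕ) [Fact p.Prime] (r : ℕ)

/-- The user spans have codimension `r`, so `r + 1` of them in general position meet in dimension
`1`. All but user `k` meet in dimension `r + 1`, complementary to the `r * r` dimensions of side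
information of `k`; hence the common vector avoids every side span. -/
theorem generically_optCost_le_one :
    Generically p (r + 1) (r * (r + 1) + 1) 1 (r * r) fun _ I => optCost I ≤ 1 := by
  have h1 := Generically.forall fun k : Fin (r + 1) => generically_finrank_userSpan_eq p
    (d := r * (r + 1) + 1) (m := 1) (m' := r * r) k
  have h2 := Generically.forall fun t : {t : Finset (Fin (r + 1)) × Fin (r + 1) // t.2 ∉ t.1} =>
    generically_finrank_userSpan p (d := r * (r + 1) + 1) (m := 1) (m' := r * r) t.1.2
      (fun n I => t.1.1.inf I.userSpan) fun n I w => Finset.inf_congr rfl fun j hj =>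
        I.userSpan_add_ofCols_of_ne (fun h => t.2 (by rwa [← h])) w
  have h3 := Generically.forall fun k : Fin (r + 1) =>
    generically_finrank_sideSpan p (d := r * (r + 1) + 1) (m := 1) (m' := r * r) k
      (fun n I => (Finset.univ.erase k).inf I.userSpan) fun n I w =>
        Finset.inf_congr rfl fun j hj => I.userSpan_add_ofCols_of_ne (Finset.ne_of_mem_erase hj) w
  refine ((h1.and h2).and h3).mono (Eventually.of_forall fun n I hI => ?_)
  obtain ⟨⟨g1, g2⟩, g3⟩ := hI
  have hsq : r * (r + 1) = r * r + r := by ring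
  have hfin : ∀ s : Finset (Fin (r + 1)),
      Module.finrank (GaloisField p n) ↥(s.inf I.userSpan) + s.card * r = r * (r + 1) + 1 := by
    intro s
    induction s using Finset.induction_on with
    | empty => rw [Finset.inf_empty, finrank_top]; simp
    | insert j s hj ih =>
      have hs : s.card + 1 ≤ r + 1 := by
        rw [← Finset.card_insert_of_notMem hj]
        simpa using Finset.card_le_univ (insert j s)
      have hs' : s.card * r ≤ r * r := Nat.mul_le_mul_right r (by omega)
      have e1 := g1 j
      have e2 := g2 ⟨(s, j), hj⟩
      have e3 := Submodule.finrank_sup_add_finrank_inf_eq (s.inf I.userSpan) (I.userSpan j)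
      rw [Finset.inf_insert, Finset.card_insert_of_notMem hj, inf_comm, add_mul]
      simp only at e2
      rw [min_eq_right (by omega)] at e1
      rw [min_eq_left (by omega)] at e2
      omega
  have huniv := hfin Finset.univ
  rw [Finset.card_univ, Fintype.card_fin, add_mul] at huniv
  have hne : Finset.univ.inf I.userSpan ≠ ⊥ := by
    intro h
    rw [h, finrank_bot] at huniv
    omega
  obtain ⟨w, hw, hw0⟩ := Submodule.exists_mem_ne_zero_of_ne_bot hne
  have hwk : ∀ k, w ∈ I.userSpan k := fun k => (Finset.inf_le (f := I.userSpan) (Finset.mem_univ k) : _ ≤ _) hw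
  refine optCost_le_one_of_common I w hwk fun k hk => hw0 ?_
  have e1 := hfin (Finset.univ.erase k)
  rw [Finset.card_erase_of_mem (Finset.mem_univ k), Finset.card_univ, Fintype.card_fin,
    Nat.add_sub_cancel] at e1
  have e2 := g3 k
  have e3 := Submodule.finrank_sup_add_finrank_inf_eq ((Finset.univ.erase k).inf I.userSpan)
    (I.sideSpan k)
  have e4 : Module.finrank (GaloisField p n) (I.sideSpan k) ≤ r * r := by
    have := finrank_range_le_card (R := GaloisField p n) (I.side k).transpose
    rwa [Fintype.card_fin] at this
  rw [min_eq_left (by omega)] at e2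
  have e5 : (Finset.univ.erase k).inf I.userSpan ⊓ I.sideSpan k = ⊥ :=
    Submodule.finrank_eq_zero.1 (by omega)
  rw [← Submodule.mem_bot (GaloisField p n), ← e5]
  exact ⟨(Finset.inf_mono (f := I.userSpan) (Finset.erase_subset k _) : _ ≤ _) hw, hk⟩

theorem isGenericCost_one : IsGenericCost p (r + 1) (r * (r + 1) + 1) 1 (r * r) 1 := by
  intro ε hε
  have hsq : r * (r + 1) = r * r + r := by ring
  have h := generically_div_le_optCost p (K := r + 1) (d := r * (r + 1) + 1) (m := 1)
    (m' := r * r) (by omega) (k := 1) (c := 1) (by omega) one_pos (by omega)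
  refine (h.and (generically_optCost_le_one p r)).mono (Eventually.of_forall fun n I hI => ?_)
  obtain ⟨h1, h2⟩ := hI
  norm_num at h1
  rw [le_antisymm h2 h1]
  simpa using hε

end CommonVector

/-! ### Interference alignment -/

section Alignment

variable {F : Type} [Field F]

/-- Powers of `θ` times monomials of degree less than `N` in each of the variables `z`. -/
def alignFamily {σ : Type} [Fintype σ] (θ : F) (u S N : ℕ) (z : σ → F) :
    (Fin S × Fin u) × (σ → Fin N) → F :=
  fun i => θ ^ (u * i.1.1.val + i.1.2.val) * ∏ t, z t ^ (i.2 t).val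

/-- The entries of independent combinations of the columns of the users that all involve the
demands. -/
def alignVars {K d m' : ℕ} (θ : F) (I : Inst F K d 1 m') : Fin K × Fin (m' + 1) × Fin d → F :=
  fun t => θ ^ t.2.1.val * I.demand t.1 t.2.2 0 +
    Fin.cases (motive := fun _ => F) 0 (fun i => I.side t.1 t.2.2 i) t.2.1

theorem sum_mul_alignVars {K d m' : ℕ} (θ : F) (I : Inst F K d 1 m') (k : Fin K)
    (i : Fin (m' + 1)) (δ : Fin d → F) (hδ : ∀ l, ∑ j, δ j * I.side k j l = 0) :
    ∑ j, alignVars θ I (k, i, j) * δ j = θ ^ i.val * ∑ j, δ j * I.demand k j 0 := by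
  have h : ∑ j, (Fin.cases (motive := fun _ => F) 0 (fun l => I.side k j l) i) * δ j = 0 := by
    induction i using Fin.cases with
    | zero => simp
    | succ l => simpa [mul_comm] using hδ l
  simp only [alignVars, add_mul, Finset.sum_add_distrib, h, add_zero, Finset.mul_sum]
  exact Finset.sum_congr rfl fun j _ => by ring

variable {p : ℕ} [Fact p.Prime] [Finite F] [Algebra (ZMod p) F]

theorem exists_finrank_complement {ι : Type} [Fintype ι] {f : ι → F}
    (hf : LinearIndependent (ZMod p) f) {r : ℕ}
    (hr : Module.finrank (ZMod p) F = Fintype.card ι + r) :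
    ∃ β : Fin r → F, Submodule.span (ZMod p) (Set.range f) ⊔
      Submodule.span (ZMod p) (Set.range β) = ⊤ := by
  obtain ⟨C, hC⟩ := (Submodule.span (ZMod p) (Set.range f)).exists_isCompl
  have h1 := Submodule.finrank_add_eq_of_isCompl hC
  rw [finrank_span_eq_card hf] at h1
  let b := Module.finBasisOfFinrankEq (ZMod p) C (n := r) (by omega)
  refine ⟨fun i => b i, ?_⟩
  have h2 : Submodule.span (ZMod p) (Set.range fun i => (b i : F)) = C := by
    have : (Set.range fun i => (b i : F)) = C.subtype '' Set.range b := by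
      rw [← Set.range_comp]; rfl
    rw [this, Submodule.span_image, b.span_eq, Submodule.map_top, Submodule.range_subtype]
  rw [h2, hC.sup_eq_top]

/-- The encoder sends `ZMod p`-linear functionals of the data, weighted by monomials in `z =
alignVars θ I`. For a data difference invisible to the side information of user `k`, pairing with `z
(k, i, ·)` multiplies the demand by `θ ^ i`, so monomials of exponents at most `N` reveal `m' + 1`
functionals of the demand for each monomial of exponents below `N`. The same symbols serve all
users. The `r` functionals still missing are sent to each user separately. -/
theorem optCost_le_of_linearIndependent {K d m' n : ℕ}
    (hn : Module.finrank (ZMod p) F = n) (I : Inst F K d 1 m') (θ : F) {S N r : ℕ}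
    (hI : LinearIndependent (ZMod p) (alignFamily θ (m' + 1) S N (alignVars θ I)))
    (hr : n = (m' + 1) * S * N ^ (K * ((m' + 1) * d)) + r) :
    optCost I ≤ (d * S * (N + 1) ^ (K * ((m' + 1) * d)) + K * r : ℝ) / n := by
  have := Fintype.ofFinite F
  have hp : p.Prime := Fact.out
  have hn0 : 0 < n := hn ▸ Module.finrank_pos
  obtain ⟨β, hβ⟩ := exists_finrank_complement hI (r := r) (by
    rw [hn, hr]
    simp only [Fintype.card_prod, Fintype.card_fun, Fintype.card_fin]
    ring)
  obtain ⟨τ, hτ⟩ : ∃ τ : Module.Dual (ZMod p) F, τ 1 ≠ 0 := by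
    by_contra! h
    exact one_ne_zero ((Module.forall_dual_apply_eq_zero_iff (ZMod p) (1 : F)).1 h)
  let z := alignVars θ I
  let σ := Fin K × Fin (m' + 1) × Fin d
  let Φ₁ : Matrix (Fin d) (Fin 1) F → (Fin S × (σ → Fin (N + 1)) × Fin d → ZMod p) := fun x t =>
    τ (θ ^ ((m' + 1) * t.1.val) * (∏ s, z s ^ (t.2.1 s).val) * x t.2.2 0)
  let Φ₂ : Matrix (Fin d) (Fin 1) F → (Fin K × Fin r → ZMod p) := fun x t =>
    τ (β t.2 * ∑ j, x j 0 * I.demand t.1 j 0)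
  let s : Scheme I := Scheme.ofEncode 1 one_pos
    ((Fin S × (σ → Fin (N + 1)) × Fin d → ZMod p) × (Fin K × Fin r → ZMod p))
    (fun x => (Φ₁ x, Φ₂ x)) (by
    intro k x y hxy hside
    obtain ⟨h1, h2⟩ := Prod.ext_iff.1 hxy
    let δ : Fin d → F := fun j => x j 0 - y j 0
    have hδ : ∀ l, ∑ j, δ j * I.side k j l = 0 := by
      intro l
      have := congrFun (congrFun hside 0) l
      simp only [Matrix.mul_apply, Matrix.transpose_apply] at this
      simp only [δ, sub_mul, Finset.sum_sub_distrib, this, sub_self]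
    -- The aligned family and `β` together span `F` over `ZMod p`, so it suffices to check these
    -- `a`.
    have key : ∀ a : F, τ (a * ∑ j, δ j * I.demand k j 0) = 0 := by
      intro a
      let g : F →ₗ[ZMod p] ZMod p :=
        τ ∘ₗ LinearMap.mulRight (ZMod p) (∑ j, δ j * I.demand k j 0)
      have hg : ∀ a, g a = τ (a * ∑ j, δ j * I.demand k j 0) := fun a => rfl
      have hle : (⊤ : Submodule (ZMod p) F) ≤ LinearMap.ker g := by
        rw [← hβ, sup_le_iff, Submodule.span_le, Submodule.span_le]
        constructor
        · rintro _ ⟨⟨⟨a, i⟩, e⟩, rfl⟩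
          rw [SetLike.mem_coe, LinearMap.mem_ker, hg]
          have e1 : alignFamily θ (m' + 1) S N (alignVars θ I) ((a, i), e) *
              ∑ j, δ j * I.demand k j 0 = ∑ j, θ ^ ((m' + 1) * a.val) *
                ((∏ s, z s ^ (e s).val) * z (k, i, j)) * δ j := by
            have e2 := sum_mul_alignVars θ I k i δ hδ
            calc _ = θ ^ ((m' + 1) * a.val) * (∏ s, z s ^ (e s).val) *
                  (θ ^ i.val * ∑ j, δ j * I.demand k j 0) := by
                  simp only [alignFamily, pow_add, z]; ring
              _ = _ := by
                  rw [← e2, Finset.mul_sum]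
                  exact Finset.sum_congr rfl fun j _ => by ring
          rw [e1, map_sum]
          refine Finset.sum_eq_zero fun j _ => ?_
          -- Multiplying by one more variable raises one exponent by one; this is why the encoder
          -- uses `N + 1` exponents where the decoder uses `N`.
          let e' : σ → Fin (N + 1) := fun s =>
            ⟨(e s).val + if s = (k, i, j) then 1 else 0, by split_ifs <;> omega⟩
          have e3 : (∏ s, z s ^ (e s).val) * z (k, i, j) = ∏ s, z s ^ (e' s).val := by
            simp only [e', pow_add, Finset.prod_mul_distrib]
            congr 1
            rw [Finset.prod_eq_single (k, i, j)] <;> simp +contextual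
          rw [e3]
          have e4 := congrFun h1 (a, e', j)
          simp only [Φ₁] at e4
          simp only [δ, mul_sub, map_sub, e4, sub_self]
        · rintro _ ⟨i, rfl⟩
          rw [SetLike.mem_coe, LinearMap.mem_ker, hg]
          have e4 := congrFun h2 (k, i)
          simp only [Φ₂] at e4
          simp only [δ, sub_mul, Finset.sum_sub_distrib, mul_sub, map_sub, e4, sub_self]
      exact hle (Submodule.mem_top (x := a))
    have h0 : ∑ j, δ j * I.demand k j 0 = 0 := by
      by_contra hne
      have := key (∑ j, δ j * I.demand k j 0)⁻¹
      rw [inv_mul_cancel₀ hne] at this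
      exact hτ this
    ext l i
    rw [Subsingleton.elim l 0, Subsingleton.elim i 0]
    simp only [Matrix.mul_apply, Matrix.transpose_apply]
    simp only [δ, sub_mul, Finset.sum_sub_distrib] at h0
    exact sub_eq_zero.1 h0)
  refine (optCost_le s).trans (le_of_eq ?_)
  change Real.logb (Nat.card F) (Nat.card ((Fin S × (σ → Fin (N + 1)) × Fin d → ZMod p) ×
    (Fin K × Fin r → ZMod p))) / ((1 : ℕ) : ℝ) = _
  have hF : Nat.card F = p ^ n := by
    rw [Module.natCard_eq_pow_finrank (K := ZMod p), hn, Nat.card_zmod]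
  have hA : Nat.card ((Fin S × (σ → Fin (N + 1)) × Fin d → ZMod p) ×
      (Fin K × Fin r → ZMod p)) =
      p ^ (d * S * (N + 1) ^ (K * ((m' + 1) * d)) + K * r) := by
    rw [Nat.card_prod, Nat.card_fun, Nat.card_fun, Nat.card_zmod, ← pow_add]
    congr 1
    simp [σ]
    ring
  have hlp : Real.log p ≠ 0 := (Real.log_pos (by exact_mod_cast hp.one_lt)).ne'
  have hn' : (n : ℝ) ≠ 0 := by positivity
  rw [hF, hA, Real.logb]
  push_cast
  rw [Real.log_pow, Real.log_pow]
  push_cast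
  field_simp

end Alignment

/-! ### Linear independence of random monomials -/

section RandomMonomials

/-- The change of variables is triangular. Hence a uniform instance yields independent uniform
variables `z`. -/
theorem alignVars_bijective {F : Type} [Field F] {K d m' : ℕ} (θ : F) :
    Function.Bijective (alignVars θ : Inst F K d 1 m' → _) := by
  constructor
  · intro I J h
    have hd : ∀ k j, I.demand k j 0 = J.demand k j 0 := by
      intro k j
      simpa [alignVars] using congrFun h (k, 0, j)
    have hs : ∀ k j l, I.side k j l = J.side k j l := by
      intro k j l
      have := congrFun h (k, l.succ, j)
      simpa [alignVars, hd] using this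
    refine Prod.ext ?_ ?_
    · funext k
      ext j i
      rw [Subsingleton.elim i 0]
      exact hd k j
    · funext k
      ext j l
      exact hs k j l
  · intro z
    refine ⟨(fun k => Matrix.of fun j _ => z (k, 0, j), fun k => Matrix.of fun j l =>
      z (k, l.succ, j) - θ ^ (l.val + 1) * z (k, 0, j)), ?_⟩
    funext ⟨k, i, j⟩
    induction i using Fin.cases with
    | zero => simp [alignVars, Inst.demand]
    | succ l => simp [alignVars, Inst.demand, Inst.side]

variable {F : Type} [Field F] [Finite F]

theorem prob_congr_equiv {α β : Type} (e : α ≃ β) (P : β → Prop) :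
    prob α (fun a => P (e a)) = prob β P := by
  unfold prob
  rw [Nat.card_congr e, Nat.card_congr (e.subtypeEquiv fun a => Iff.rfl)]

theorem prob_eval_eq_zero_le {σ : Type} [Fintype σ] {P : MvPolynomial σ F} (hP : P ≠ 0) {D : ℕ}
    (hD : P.totalDegree ≤ D) :
    prob (σ → F) (fun z => MvPolynomial.eval z P = 0) ≤ D / Nat.card F := by
  classical
  have := Fintype.ofFinite F
  let e := Fintype.equivFin σ
  have h0 : MvPolynomial.rename e P ≠ 0 := by
    rwa [Ne, MvPolynomial.rename_eq_zero_iff_of_injective _ e.injective]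
  have h1 := MvPolynomial.schwartz_zippel_totalDegree h0 (Finset.univ : Finset F)
  have h2 : prob (σ → F) (fun z => MvPolynomial.eval z P = 0) =
      prob (Fin (Fintype.card σ) → F) fun z => MvPolynomial.eval z (MvPolynomial.rename e P) = 0 :=
    by
    rw [← prob_congr_equiv (e.arrowCongr (Equiv.refl F))]
    congr 1
    funext z
    rw [MvPolynomial.eval_rename]
    congr 3
    funext s
    simp
  have h3 : (prob (Fin (Fintype.card σ) → F) fun z =>
      MvPolynomial.eval z (MvPolynomial.rename e P) = 0) ≤
      (MvPolynomial.rename e P).totalDegree / Nat.card F := by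
    have h4 : ((_ : ℚ≥0) : ℝ) ≤ ((_ : ℚ≥0) : ℝ) := NNRat.cast_le.2 h1
    push_cast at h4
    rw [Finset.card_univ (α := F), ← Nat.card_eq_fintype_card (α := F)] at h4
    refine le_of_eq_of_le ?_ h4
    rw [prob, Nat.card_eq_fintype_card, Fintype.card_subtype, Nat.card_eq_fintype_card]
    simp
  rw [h2]
  refine h3.trans ?_
  gcongr
  exact (MvPolynomial.totalDegree_rename_le _ _).trans hD

variable {p : ℕ} [Fact p.Prime] [Algebra (ZMod p) F]

/-- A relation with coefficients `a` is a polynomial equation in `z`. Its coefficients are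
combinations over `ZMod p` of distinct powers of `θ` below `n`, so the polynomial is nonzero and the
Schwartz–Zippel bound applies. -/
theorem prob_sum_smul_alignFamily_eq_zero_le {σ : Type} [Fintype σ] [DecidableEq σ] {θ : F} {u S N n : ℕ}
    (hθ : LinearIndependent (ZMod p) fun i : Fin n => θ ^ i.val) (hS : u * S ≤ n)
    {a : (Fin S × Fin u) × (σ → Fin N) → ZMod p} (ha : a ≠ 0) :
    prob (σ → F) (fun z => ∑ i, a i • alignFamily θ u S N z i = 0) ≤
      (Fintype.card σ * N : ℕ) / Nat.card F := by
  classical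
  let ex : (σ → Fin N) → (σ →₀ ℕ) := fun e => Finsupp.equivFunOnFinite.symm fun t => (e t).val
  have hex : Function.Injective ex := by
    intro e e' h
    funext t
    exact Fin.ext (DFunLike.congr_fun h t)
  let co : (σ → Fin N) → F := fun e => ∑ i : Fin S × Fin u,
    a (i, e) • θ ^ (u * i.1.val + i.2.val)
  let P : MvPolynomial σ F := ∑ e : σ → Fin N, MvPolynomial.monomial (ex e) (co e)
  have hco : ∀ e, MvPolynomial.coeff (ex e) P = co e := by
    intro e
    simp only [P, MvPolynomial.coeff_sum, MvPolynomial.coeff_monomial, hex.eq_iff]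
    simp
  have hP : P ≠ 0 := by
    intro h
    refine ha (funext fun ⟨i, e⟩ => ?_)
    have h1 : co e = 0 := by rw [← hco, h, MvPolynomial.coeff_zero]
    -- Division with remainder by `u` makes the exponents distinct.
    let idx : Fin S × Fin u → Fin n := fun i => ⟨u * i.1.val + i.2.val, by
      have h2 : u * i.1.val + u ≤ u * S := by
        rw [← Nat.mul_succ]; exact Nat.mul_le_mul_left u i.1.isLt
      have := i.2.isLt
      omega⟩
    have hidx : Function.Injective idx := by
      rintro ⟨s, i⟩ ⟨s', i'⟩ h2
      have h3 : u * s.val + i.val = u * s'.val + i'.val := congrArg Fin.val h2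
      have hu : 0 < u := i.pos
      have h4 : s.val = s'.val := by
        have := congrArg (· / u) h3
        simpa [Nat.mul_add_div hu, Nat.div_eq_of_lt i.isLt, Nat.div_eq_of_lt i'.isLt] using this
      rw [h4] at h3
      exact Prod.ext (Fin.ext h4) (Fin.ext (by simpa using h3))
    exact Fintype.linearIndependent_iff.1 (hθ.comp idx hidx) (fun i => a (i, e)) h1 i
  have hdeg : P.totalDegree ≤ Fintype.card σ * N := by
    refine MvPolynomial.totalDegree_finsetSum_le fun e _ => ?_
    refine (MvPolynomial.totalDegree_monomial_le _ _).trans ?_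
    rw [Finsupp.sum_fintype _ _ (fun _ => rfl), ← Finset.card_univ, ← smul_eq_mul]
    exact Finset.sum_le_card_nsmul _ _ _ fun t _ => (e t).isLt.le
  refine le_of_eq_of_le ?_ (prob_eval_eq_zero_le hP hdeg)
  congr 1
  funext z
  congr 1
  simp only [P, map_sum, MvPolynomial.eval_monomial]
  rw [Fintype.sum_prod_type_right]
  refine Finset.sum_congr rfl fun e _ => ?_
  rw [Finsupp.prod_fintype _ _ (fun _ => pow_zero _)]
  simp only [co, Finset.sum_mul]
  refine Finset.sum_congr rfl fun i _ => ?_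
  simp only [alignFamily, ex, Finsupp.equivFunOnFinite_symm_apply_apply, smul_mul_assoc]

theorem prob_not_linearIndependent_alignFamily_le {σ : Type} [Fintype σ] [DecidableEq σ] {θ : F} {u S N n : ℕ}
    (hθ : LinearIndependent (ZMod p) fun i : Fin n => θ ^ i.val) (hS : u * S ≤ n) :
    prob (σ → F) (fun z => ¬ LinearIndependent (ZMod p) (alignFamily θ u S N z)) ≤
      p ^ (u * S * N ^ Fintype.card σ) * ((Fintype.card σ * N : ℕ) / Nat.card F : ℝ) := by
  classical
  calc _ ≤ prob (σ → F) (fun z => ∃ a : {a : (Fin S × Fin u) × (σ → Fin N) → ZMod p // a ≠ 0},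
        ∑ i, a.1 i • alignFamily θ u S N z i = 0) := by
        refine prob_mono fun z hz => ?_
        obtain ⟨g, hg, i, hi⟩ := Fintype.not_linearIndependent_iff.1 hz
        exact ⟨⟨g, fun h => hi (congrFun h i)⟩, hg⟩
    _ ≤ ∑ a : {a : (Fin S × Fin u) × (σ → Fin N) → ZMod p // a ≠ 0},
        prob (σ → F) (fun z => ∑ i, a.1 i • alignFamily θ u S N z i = 0) := prob_exists_le _
    _ ≤ ∑ a : {a : (Fin S × Fin u) × (σ → Fin N) → ZMod p // a ≠ 0},
        ((Fintype.card σ * N : ℕ) / Nat.card F : ℝ) :=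
        Finset.sum_le_sum fun a _ => prob_sum_smul_alignFamily_eq_zero_le hθ hS a.2
    _ ≤ _ := by
        rw [Finset.sum_const, nsmul_eq_mul]
        gcongr
        have h : Fintype.card {a : (Fin S × Fin u) × (σ → Fin N) → ZMod p // a ≠ 0} ≤
            Fintype.card ((Fin S × Fin u) × (σ → Fin N) → ZMod p) := Fintype.card_subtype_le _
        have h2 : Fintype.card ((Fin S × Fin u) × (σ → Fin N) → ZMod p) =
            p ^ (u * S * N ^ Fintype.card σ) := by
          rw [Fintype.card_fun, ZMod.card]
          congr 1
          simp only [Fintype.card_prod, Fintype.card_fun, Fintype.card_fin]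
          ring
        rw [h2] at h
        exact_mod_cast h

theorem exists_linearIndependent_pow {n : ℕ} (hn : Module.finrank (ZMod p) F = n) :
    ∃ θ : F, LinearIndependent (ZMod p) fun i : Fin n => θ ^ i.val := by
  let pb := Field.powerBasisOfFiniteOfSeparable (ZMod p) F
  have h : pb.dim = n := by rw [← pb.finrank, hn]
  refine ⟨pb.gen, ?_⟩
  subst h
  have := pb.basis.linearIndependent
  rwa [pb.coe_basis] at this

/-- The union bound runs over at most `p ^ (n - r)` coefficient vectors, each failing with
probability of order `p ^ (-n)`. The `r` unaligned dimensions thus provide the factor `p ^ (-r)`. -/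
theorem prob_optCost_gt_le {K d m' n : ℕ} (hn : Module.finrank (ZMod p) F = n) {S N r : ℕ}
    (hN : 0 < N) (hr : n = (m' + 1) * S * N ^ (K * ((m' + 1) * d)) + r) :
    prob (Inst F K d 1 m') (fun I => ¬ optCost I ≤
      (d * S * (N + 1) ^ (K * ((m' + 1) * d)) + K * r : ℝ) / n) ≤
      (K * ((m' + 1) * d) * N : ℕ) / (p : ℝ) ^ r := by
  obtain ⟨θ, hθ⟩ := exists_linearIndependent_pow hn
  have hS : (m' + 1) * S ≤ n := by
    have : (m' + 1) * S * 1 ≤ (m' + 1) * S * N ^ (K * ((m' + 1) * d)) :=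
      Nat.mul_le_mul_left _ (Nat.pow_pos hN)
    omega
  have hc : Fintype.card (Fin K × Fin (m' + 1) × Fin d) = K * ((m' + 1) * d) := by simp
  have h1 := prob_not_linearIndependent_alignFamily_le (σ := Fin K × Fin (m' + 1) × Fin d)
    (N := N) hθ hS
  rw [← prob_congr_equiv (Equiv.ofBijective _ (alignVars_bijective (K := K) (d := d) (m' := m') θ))]
    at h1
  refine (prob_mono fun I hI hlin =>
    hI (optCost_le_of_linearIndependent hn I θ hlin hr)).trans (h1.trans (le_of_eq ?_))
  · rw [hc, Module.natCard_eq_pow_finrank (K := ZMod p), hn, Nat.card_zmod]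
    have hp : (p : ℝ) ≠ 0 := by exact_mod_cast (Fact.out : p.Prime).ne_zero
    conv_lhs => rw [hr]
    push_cast
    rw [pow_add]
    field_simp

end RandomMonomials

/-! ### The generic cost for many users with one demand each -/

section ManyUsersCost

variable (p : ℕ) [Fact p.Prime] {K d m' : ℕ}

/-- The slack `ε` is split in three: a large `N` makes the alignment overhead `((N + 1) / N) ^ T`
harmless, reserving about `n / t` unaligned dimensions costs `K / t`, and rounding costs at most `K
* M / n`. The reserve grows with `n`, so the failure probability tends to `0`. -/
theorem generically_optCost_le_add {ε : ℝ} (hε : 0 < ε) :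
    Generically p K d 1 m' fun _ I => optCost I ≤ d / (m' + 1) + ε := by
  have hp : (1 : ℝ) < p := by exact_mod_cast (Fact.out : p.Prime).one_lt
  set T := K * ((m' + 1) * d) with hT
  obtain ⟨N, hN0, hN⟩ : ∃ N : ℕ, 0 < N ∧
      (d : ℝ) / (m' + 1) * (1 + 1 / (N : ℝ)) ^ T ≤ d / (m' + 1) + ε / 3 := by
    have h1 : Tendsto (fun N : ℕ => (d : ℝ) / (m' + 1) * (1 + 1 / (N : ℝ)) ^ T) atTop
        (𝓝 (d / (m' + 1) * (1 + 0) ^ T)) :=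
      ((tendsto_one_div_atTop_nhds_zero_nat.const_add 1).pow T).const_mul _
    rw [add_zero, one_pow, mul_one] at h1
    obtain ⟨N, h2, h3⟩ := ((eventually_gt_atTop 0).and
      (h1.eventually (ge_mem_nhds (show (d : ℝ) / (m' + 1) < d / (m' + 1) + ε / 3 by
        linarith)))).exists
    exact ⟨N, h2, h3⟩
  obtain ⟨t, ht0, ht⟩ : ∃ t : ℕ, 0 < t ∧ (K : ℝ) / t ≤ ε / 3 := by
    obtain ⟨t, h2, h3⟩ := ((eventually_gt_atTop 0).and
      ((tendsto_const_div_atTop_nhds_zero_nat (K : ℝ)).eventually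
        (ge_mem_nhds (show (0 : ℝ) < ε / 3 by linarith)))).exists
    exact ⟨t, h2, h3⟩
  set M := (m' + 1) * N ^ T with hM
  have hM0 : 0 < M := by positivity
  have hlim : Tendsto (fun n : ℕ => (T * N : ℕ) / (p : ℝ) ^ (n / t)) atTop (𝓝 0) :=
    ((tendsto_pow_atTop_atTop_of_one_lt hp).comp
      (Nat.tendsto_div_const_atTop ht0.ne')).const_div_atTop _
  refine generically_of_le hlim ?_
  filter_upwards [eventually_gt_atTop 0, (tendsto_const_div_atTop_nhds_zero_nat
    ((K * M : ℕ) : ℝ)).eventually (ge_mem_nhds (show (0 : ℝ) < ε / 3 by linarith))] with n hn0 hn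
  set S := (n - n / t) / M with hS
  have h1 : M * S ≤ n - n / t := Nat.mul_div_le _ _
  have h2 : n - n / t < M * S + M := by
    have := Nat.lt_mul_div_succ (n - n / t) hM0
    rwa [Nat.mul_add, mul_one] at this
  have h3 : n / t ≤ n := Nat.div_le_self _ _
  obtain ⟨r, hr⟩ : ∃ r, n = M * S + r := Nat.exists_eq_add_of_le (h1.trans (Nat.sub_le _ _))
  have hr1 : n / t ≤ r := by omega
  have hr2 : r ≤ n / t + M := by omega
  have hn0' : (0 : ℝ) < n := by exact_mod_cast hn0
  have ht0' : (0 : ℝ) < t := by exact_mod_cast ht0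
  have hN0' : (0 : ℝ) < N := by exact_mod_cast hN0
  have key := prob_optCost_gt_le (F := GaloisField p n) (d := d) (K := K) (m' := m') (S := S)
    (N := N) (r := r) (GaloisField.finrank p hn0.ne') hN0 (by rw [← hT]; rw [hr, hM]; ring)
  have hcost : (d * S * (N + 1) ^ (K * ((m' + 1) * d)) + K * r : ℝ) / n ≤ d / (m' + 1) + ε := by
    rw [← hT, add_div]
    have e1 : (d * S * (N + 1) ^ T : ℝ) / n ≤ d / (m' + 1) + ε / 3 := by
      refine le_trans ?_ hN
      have e2 : ((m' + 1) * N ^ T * S : ℝ) ≤ n := by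
        have : M * S ≤ n := h1.trans (Nat.sub_le _ _)
        rw [hM] at this
        exact_mod_cast this
      have e3 : (1 + 1 / (N : ℝ)) ^ T = (N + 1) ^ T / N ^ T := by
        rw [← div_pow]; congr 1; field_simp
      rw [e3, div_le_iff₀ hn0']
      calc (d * S * (N + 1) ^ T : ℝ) = d / (m' + 1) * ((N + 1) ^ T / N ^ T) *
            ((m' + 1) * N ^ T * S) := by field_simp
        _ ≤ _ := by gcongr
    have e4 : (K * r : ℝ) / n ≤ ε / 3 + ε / 3 := by
      have e5 : (r : ℝ) ≤ n / t + M := by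
        have : ((n / t : ℕ) : ℝ) ≤ n / t := Nat.cast_div_le
        have e6 : (r : ℝ) ≤ (n / t : ℕ) + M := by exact_mod_cast hr2
        linarith
      calc (K * r : ℝ) / n ≤ K * (n / t + M) / n := by gcongr
        _ = K / t + (K * M : ℕ) / n := by push_cast; field_simp
        _ ≤ _ := add_le_add ht hn
    linarith
  refine (prob_mono fun I hI hle => hI (hle.trans hcost)).trans (key.trans ?_)
  rw [← hT]
  gcongr
  exact hp.le

/-- With at least `d` users that have one demand each, the generic cost is `d / (m' + 1)`. -/
theorem isGenericCost_of_le (h : m' + 1 ≤ d) (hK : d ≤ K) :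
    IsGenericCost p K d 1 m' (d / (m' + 1)) := by
  intro ε hε
  -- The converse with `k = d` and `c = 1 + m'` is tight: `k * (m + m') = c * d`.
  have h1 := generically_div_le_optCost p (K := K) (d := d) (m := 1) (m' := m') (by omega) hK
    (c := 1 + m') (by omega) (by rw [mul_comm])
  refine (h1.and (generically_optCost_le_add p (half_pos hε))).mono
    (Eventually.of_forall fun n I hI => ?_)
  obtain ⟨h2, h3⟩ := hI
  push_cast at h2
  rw [mul_one, add_comm (1 : ℝ)] at h2
  rw [abs_lt]
  constructor <;> linarith

end ManyUsersCost

/-! ### Gains over the baseline schemes -/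

section Gains

variable {K d m m' : ℕ}

theorem baselineRate_eq (K d m m' : ℕ) :
    baselineRate K d m m' = ((min (d - m') (K * m) : ℕ) : ℝ≥0∞)⁻¹ := by
  unfold baselineRate
  rw [one_div, one_div, ← Nat.cast_mul]
  rcases le_total (d - m') (K * m) with h | h
  · rw [min_eq_left h, max_eq_left]
    exact ENNReal.inv_le_inv.2 (by exact_mod_cast h)
  · rw [min_eq_right h, max_eq_right]
    exact ENNReal.inv_le_inv.2 (by exact_mod_cast h)

theorem gain_eq (K d m m' : ℕ) {Δ : ℝ} (hΔ : 0 < Δ) :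
    1 / ENNReal.ofReal Δ / baselineRate K d m m' =
      ENNReal.ofReal ((min (d - m') (K * m) : ℕ) / Δ) := by
  rw [baselineRate_eq, div_eq_mul_inv _ (_⁻¹), inv_inv, one_div, mul_comm,
    ENNReal.ofReal_div_of_pos hΔ, ENNReal.ofReal_natCast, div_eq_mul_inv]

theorem envelopeGain_eq (K : ℕ) (hm : 0 < m) (hd : m' < d) :
    envelopeRate d m m' / baselineRate K d m m' =
      ENNReal.ofReal ((m + m') * (min (d - m') (K * m) : ℕ) / (m * d)) := by
  have hmd : (0 : ℝ) < m * d := by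
    have : 0 < m * d := Nat.mul_pos hm (by omega)
    exact_mod_cast this
  rw [baselineRate_eq, div_eq_mul_inv _ (_⁻¹), inv_inv, envelopeRate,
    ENNReal.ofReal_div_of_pos hmd]
  have h1 : ENNReal.ofReal ((m : ℝ) * d) = (m : ℝ≥0∞) * d := by
    rw [← Nat.cast_mul, ENNReal.ofReal_natCast, Nat.cast_mul]
  have h2 : ENNReal.ofReal ((m + m') * (min (d - m') (K * m) : ℕ)) =
      ((m : ℝ≥0∞) + m') * (min (d - m') (K * m) : ℕ) := by
    rw [← Nat.cast_add, ← Nat.cast_mul, ENNReal.ofReal_natCast]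
    push_cast
    rfl
  rw [h1, h2, div_eq_mul_inv, div_eq_mul_inv, mul_right_comm]

/-- With `s = m + m' ≤ d`, the bound `d - m' = (d - s) + m ≤ m * (d - s + 1)` removes the factor
`m`, and `s * (d - s + 1) ≤ (d + 1) ^ 2 / 4`. -/
theorem sub_mul_add_le (hm : 0 < m) (hd : m' < d) :
    ((d : ℝ) - m') * (m + m') ≤ (d / 4 + 1) * (m * d) := by
  have hm1 : (1 : ℝ) ≤ m := by exact_mod_cast hm
  have hm0 : (0 : ℝ) ≤ m' := Nat.cast_nonneg _
  have hd1 : (m' : ℝ) + 1 ≤ d := by exact_mod_cast hd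
  rcases le_total (m + m' : ℝ) d with h | h
  · have h1 : (d : ℝ) - m' ≤ m * (d - (m + m') + 1) := by nlinarith
    have h2 : 4 * ((d - (m + m') + 1) * (m + m') : ℝ) ≤ d ^ 2 + 4 * d := by
      nlinarith [sq_nonneg ((d : ℝ) + 1 - 2 * (m + m'))]
    calc ((d : ℝ) - m') * (m + m') ≤ m * (d - (m + m') + 1) * (m + m') := by gcongr
      _ = m * ((d - (m + m') + 1) * (m + m')) := by ring
      _ ≤ m * ((d ^ 2 + 4 * d) / 4) := by gcongr; linarith
      _ = _ := by ring
  · have h1 : ((d : ℝ) - m') * (m + m') ≤ m * d := by nlinarith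
    have h2 : 0 ≤ (d / 4 : ℝ) * (m * d) := by positivity
    linarith

theorem min_le_users (K d m m' : ℕ) :
    ((min (d - m') (K * m) : ℕ) : ℝ) ≤ K * m := by
  exact_mod_cast min_le_right _ _

theorem min_le_sub (hd : m' < d) :
    ((min (d - m') (K * m) : ℕ) : ℝ) ≤ d - m' := by
  rw [← Nat.cast_sub hd.le]
  exact_mod_cast min_le_left _ _

theorem envelope_le_users (hK : 0 < K) (hm : 0 < m) (hd : m' < d) :
    (m + m' : ℝ) * (min (d - m') (K * m) : ℕ) ≤ K * (m * d) := by
  have hm1 : (1 : ℝ) ≤ m := by exact_mod_cast hm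
  have hK1 : (1 : ℝ) ≤ K := by exact_mod_cast hK
  have hm0 : (0 : ℝ) ≤ m' := Nat.cast_nonneg _
  have hd1 : (m' : ℝ) + 1 ≤ d := by exact_mod_cast hd
  have h1 := min_le_users K d m m'
  have h2 := min_le_sub (K := K) (m := m) hd
  rcases le_total (m + m' : ℝ) d with h | h
  · calc _ ≤ (d : ℝ) * (K * m) := by gcongr
      _ = _ := by ring
  · calc _ ≤ (m + m' : ℝ) * (d - m') := by gcongr
      _ ≤ 1 * (m * d) := by nlinarith
      _ ≤ _ := by gcongr

variable {p : ℕ} [Fact p.Prime] {Δ : ℝ}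

theorem IsGenericCost.demand_le (hΔ : IsGenericCost p K d m m' Δ) (hK : 0 < K)
    (h : m + m' ≤ d) : (m : ℝ) ≤ Δ := by
  simpa using hΔ.mul_le p h (k := 1) (c := 1) hK one_pos (by omega)

theorem IsGenericCost.pos (hΔ : IsGenericCost p K d m m' Δ) (hK : 0 < K) (hm : 0 < m)
    (hd : m' < d) : 0 < Δ := by
  rcases le_total (m + m') d with h | h
  · exact lt_of_lt_of_le (by exact_mod_cast hm) (hΔ.demand_le hK h)
  · exact lt_of_lt_of_le (by rw [sub_pos]; exact_mod_cast hd) (hΔ.sub_le p hK h)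

theorem IsGenericCost.le_users_mul (hΔ : IsGenericCost p K d m m' Δ) (hK : 0 < K) (hm : 0 < m)
    (hd : m' < d) : ((min (d - m') (K * m) : ℕ) : ℝ) ≤ K * Δ := by
  have h0 := hΔ.pos hK hm hd
  have hK1 : (1 : ℝ) ≤ K := by exact_mod_cast hK
  rcases le_total (m + m') d with h | h
  · calc _ ≤ (K : ℝ) * m := min_le_users K d m m'
      _ ≤ _ := by gcongr; exact hΔ.demand_le hK h
  · calc _ ≤ (d : ℝ) - m' := min_le_sub hd
      _ ≤ 1 * Δ := by rw [one_mul]; exact hΔ.sub_le p hK h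
      _ ≤ _ := by gcongr

theorem IsGenericCost.le_mul_of_manyUsers (hΔ : IsGenericCost p K d m m' Δ) (hK : 0 < K)
    (hm : 0 < m) (hd : m' < d) (hKd : ManyUsers K d m m') :
    ((min (d - m') (K * m) : ℕ) : ℝ) ≤ (d / 4 + 1) * Δ := by
  have h0 := hΔ.pos hK hm hd
  have h1 := min_le_sub (K := K) (m := m) hd
  rcases le_total (m + m') d with h | h
  -- Having `d / gcd` users suffices to use the converse without rounding loss, which gives `d * m ≤
  -- (m + m') * Δ`.
  · have hg : 0 < Nat.gcd d (m + m') := Nat.gcd_pos_of_pos_left _ (by omega)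
    obtain ⟨a, ha⟩ := Nat.gcd_dvd_left d (m + m')
    obtain ⟨b, hb⟩ := Nat.gcd_dvd_right d (m + m')
    set g := Nat.gcd d (m + m') with hgdef
    have hb0 : 0 < b := Nat.pos_of_ne_zero (by rintro rfl; omega)
    have ha' : d / g = a := by
      conv_lhs => rw [ha]
      exact Nat.mul_div_cancel_left a hg
    have h2 := hΔ.mul_le p h (k := a) (c := b) (by rw [← ha']; exact hKd) hb0
      (le_of_eq (by
        calc a * (m + m') = a * (g * b) := by rw [← hb]
          _ = b * (g * a) := by ring
          _ = b * d := by rw [← ha]))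
    have hg' : (0 : ℝ) < g := by exact_mod_cast hg
    have h3 : (d * m : ℝ) ≤ (m + m') * Δ := by
      have e1 : (d : ℝ) = g * a := by exact_mod_cast ha
      have e2 : (m + m' : ℝ) = g * b := by exact_mod_cast hb
      rw [e1, e2]
      nlinarith
    have h4 := sub_mul_add_le hm hd
    have hu : (0 : ℝ) < m + m' := by
      have : (0 : ℝ) < m := by exact_mod_cast hm
      positivity
    refine le_of_mul_le_mul_right ?_ hu
    calc _ ≤ ((d : ℝ) - m') * (m + m') := by gcongr
      _ ≤ (d / 4 + 1) * (m * d) := h4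
      _ = (d / 4 + 1) * (d * m) := by ring
      _ ≤ (d / 4 + 1) * ((m + m') * Δ) := by gcongr
      _ = _ := by ring
  · have h2 := hΔ.sub_le p hK h
    have h3 : 0 ≤ (d / 4 : ℝ) * Δ := by positivity
    linarith

/-- Random coding is already as good as separate transmissions to `d - (m + m') + 1` users, so only
that many have to enter the converse. -/
theorem min_le_min_mul (hm : 0 < m) (h : m + m' ≤ d) :
    min (d - m') (K * m) ≤ min K (d - (m + m') + 1) * m := by
  rcases le_total K (d - (m + m') + 1) with hk | hk
  · rw [min_eq_left hk]; exact min_le_right _ _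
  · rw [min_eq_right hk]
    refine (min_le_left _ _).trans ?_
    obtain ⟨t, rfl⟩ := Nat.exists_eq_add_of_le h
    have : m + m' + t - m' = t + m := by omega
    rw [this, Nat.add_sub_cancel_left]
    nlinarith

theorem IsGenericCost.le_nat_mul (hΔ : IsGenericCost p K d m m' Δ) (hK : 0 < K) (hm : 0 < m)
    (hd : m' < d) {c : ℕ} (hc0 : 0 < c)
    (hc : ∀ x y : ℕ, x + y = d + 1 → y * x ≤ c * d) :
    ((min (d - m') (K * m) : ℕ) : ℝ) ≤ c * Δ := by
  have h0 := hΔ.pos hK hm hd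
  rcases le_total (m + m') d with h | h
  · have h1 := min_le_min_mul (K := K) hm h
    have h2 := hc (m + m') (d - (m + m') + 1) (by omega)
    have h3 := hΔ.mul_le p h (k := min K (d - (m + m') + 1)) (c := c) (min_le_left _ _) hc0
      (le_trans (Nat.mul_le_mul_right _ (min_le_right _ _)) h2)
    refine le_trans ?_ h3
    exact_mod_cast h1
  · have h1 := min_le_sub (K := K) (m := m) hd
    have h2 := hΔ.sub_le p hK h
    have hc1 : (1 : ℝ) ≤ c := by exact_mod_cast hc0
    nlinarith

/-- If `y * x` is this large, `y = 2 * j + 2 - t` with `t * t ≤ j`, so `y` is close to half of the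
sum. A failure would need `3 * t ≥ 2 * j`, hence `4 * j ≤ 9`, and `j = 2` is excluded by
integrality. -/
theorem four_mul_le_of_lt_mul {j x y : ℕ} (hj : 2 ≤ j) (hxy : x + y = 4 * j + 4)
    (h : (j + 1) * (4 * j + 3) < y * x) : 4 * (j + 1) ≤ 3 * (y - 1) := by
  by_contra hcon
  have h4 : 3 * y ≤ 4 * j + 6 := by omega
  obtain ⟨t, ht⟩ : ∃ t : ℤ, t = 2 * j + 2 - y := ⟨_, rfl⟩
  have hy : (y : ℤ) = 2 * j + 2 - t := by omega
  have hx : (x : ℤ) = 2 * j + 2 + t := by omega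
  have h1 : ((j : ℤ) + 1) * (4 * j + 3) < (2 * j + 2 - t) * (2 * j + 2 + t) := by
    rw [← hy, ← hx]; exact_mod_cast h
  have h2 : t * t ≤ j := by linarith
  have h3 : 2 * (j : ℤ) ≤ 3 * t := by omega
  have h5 : (2 * (j : ℤ)) * (2 * j) ≤ (3 * t) * (3 * t) :=
    mul_le_mul h3 h3 (by positivity) (by omega)
  have h6 : (j : ℤ) * (4 * j) ≤ j * 9 := by linarith
  have h7 : 4 * (j : ℤ) ≤ 9 := le_of_mul_le_mul_left h6 (by omega)
  obtain rfl : j = 2 := by omega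
  have h8 : 2 ≤ t := by omega
  have h9 : 2 * 2 ≤ t * t := mul_le_mul h8 h8 (by norm_num) (by omega)
  norm_num at h2
  omega

/-- Here `j + 7 / 4 = d / 4 + 1`. If `c = j + 1` is too small for all `y` users, it suffices for `y
- 1`. Dropping one loses the factor `y / (y - 1)`, which fits between `j + 1` and `j + 7 / 4`
exactly when `4 * (j + 1) ≤ 3 * (y - 1)`. -/
theorem IsGenericCost.le_mul_of_three_mod_four {j : ℕ} (hj : 2 ≤ j)
    (hΔ : IsGenericCost p K (4 * j + 3) m m' Δ) (hK : 0 < K) (hm : 0 < m)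
    (hd : m' < 4 * j + 3) :
    ((min (4 * j + 3 - m') (K * m) : ℕ) : ℝ) ≤ (j + 7 / 4) * Δ := by
  have h0 := hΔ.pos hK hm hd
  rcases le_total (m + m') (4 * j + 3) with h | h
  · have h1 := min_le_min_mul (K := K) hm h
    obtain ⟨x, hx⟩ : ∃ x, x = m + m' := ⟨_, rfl⟩
    obtain ⟨y, hy⟩ : ∃ y, y = 4 * j + 3 - (m + m') + 1 := ⟨_, rfl⟩
    rw [← hy] at h1
    have hxy : x + y = 4 * j + 4 := by omega
    obtain ⟨k, hk⟩ : ∃ k, k = min K y := ⟨_, rfl⟩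
    rw [← hk] at h1
    have hkK : k ≤ K := hk ▸ min_le_left _ _
    have hky : k ≤ y := hk ▸ min_le_right _ _
    have h1' : ((min (4 * j + 3 - m') (K * m) : ℕ) : ℝ) ≤ k * m := by exact_mod_cast h1
    have hj0 : (0 : ℝ) ≤ j := Nat.cast_nonneg j
    by_cases hc : k * x ≤ (j + 1) * (4 * j + 3)
    · have h2 := hΔ.mul_le p h (c := j + 1) hkK (by omega) (hx ▸ hc)
      push_cast at h2
      nlinarith
    · have hyx : (y - 1) * x ≤ (j + 1) * (4 * j + 3) := by
        obtain ⟨z, rfl⟩ : ∃ z, y = z + 1 := ⟨y - 1, by omega⟩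
        rw [Nat.add_sub_cancel]
        have hz : z + x = 4 * j + 3 := by omega
        zify at hz ⊢
        nlinarith [sq_nonneg ((z : ℤ) - x)]
      have hkey : k = y := by
        by_contra hne
        exact hc (le_trans (Nat.mul_le_mul_right x (by omega)) hyx)
      have hk1 : 1 ≤ k := by omega
      have h2 := hΔ.mul_le p h (k := k - 1) (c := j + 1) (by omega) (by omega)
        (by rw [← hx, hkey]; exact hyx)
      have h3 : 4 * (j + 1) ≤ 3 * (k - 1) := by
        rw [hkey] at hc ⊢
        exact four_mul_le_of_lt_mul hj hxy (not_le.1 hc)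
      push_cast [hk1] at h2
      have h3' : (4 : ℝ) * (j + 1) ≤ 3 * (k - 1) := by
        have : ((4 * (j + 1) : ℕ) : ℝ) ≤ (3 * (k - 1) : ℕ) := by exact_mod_cast h3
        push_cast [hk1] at this
        exact this
      have hj1 : (0 : ℝ) < j + 1 := by linarith
      have hm1 : (0 : ℝ) ≤ m := Nat.cast_nonneg m
      refine h1'.trans (le_of_mul_le_mul_left ?_ hj1)
      calc ((j : ℝ) + 1) * (k * m) = ((j + 1) * k) * m := by ring
        _ ≤ ((j + 7 / 4) * (k - 1)) * m :=
          mul_le_mul_of_nonneg_right (by linarith) hm1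
        _ = (j + 7 / 4) * ((k - 1) * m) := by ring
        _ ≤ (j + 7 / 4) * ((j + 1) * Δ) := by gcongr
        _ = _ := by ring
  · have h1 := min_le_sub (K := K) (m := m) hd
    have h2 := hΔ.sub_le p hK h
    have h3 : 0 ≤ (j : ℝ) * Δ := by positivity
    linarith

theorem IsGenericCost.le_mul_of_ne (hΔ : IsGenericCost p K d m m' Δ) (hK : 0 < K) (hm : 0 < m)
    (hd : m' < d) (h3 : d ≠ 3) (h7 : d ≠ 7) :
    ((min (d - m') (K * m) : ℕ) : ℝ) ≤ (d / 4 + 1) * Δ := by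
  have h0 := hΔ.pos hK hm hd
  -- For these residues `c = j + 1` satisfies `y * x ≤ c * d`; when `i = 2` this needs `y * x` to be
  -- an integer, as `(d + 1) ^ 2 / 4` exceeds `c * d` by `1 / 4`.
  have hnat : ∀ j i : ℕ, d = 4 * j + i → i ≤ 2 → 0 < d →
      ((min (d - m') (K * m) : ℕ) : ℝ) ≤ (d / 4 + 1) * Δ := by
    intro j i hdj hi hd0
    have h1 := hΔ.le_nat_mul hK hm hd (c := j + 1) (by omega) (by
      intro x y hxy
      have h4 : 4 * (y * x) ≤ (d + 1) * (d + 1) := by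
        rw [← hxy]; zify; nlinarith [sq_nonneg ((x : ℤ) - y)]
      subst hdj
      interval_cases i
      · have : 1 ≤ j := by omega
        nlinarith
      · nlinarith
      · by_contra hcon
        push Not at hcon
        nlinarith)
    refine h1.trans ?_
    gcongr
    rw [hdj]
    push_cast
    have : (0 : ℝ) ≤ i := Nat.cast_nonneg i
    linarith
  have hmod : d = 4 * (d / 4) + d % 4 := (Nat.div_add_mod d 4).symm
  rcases Nat.lt_or_ge (d % 4) 3 with h | h
  · exact hnat _ _ hmod (by omega) (by omega)
  · obtain ⟨j, rfl⟩ : ∃ j, d = 4 * j + 3 := ⟨d / 4, by omega⟩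
    refine (hΔ.le_mul_of_three_mod_four (by omega) hK hm hd).trans (le_of_eq ?_)
    push_cast
    ring

end Gains

/-! ### Extremal gains -/

section Extremal

variable {K d m m' : ℕ}

theorem gain_le_ofReal {p : ℕ} [Fact p.Prime] {C : ℝ≥0∞} {b : ℝ}
    (hC : IsGenericCapacity p K d m m' C) (hK : 0 < K) (hm : 0 < m) (hd : m' < d)
    (hb : ∀ Δ, IsGenericCost p K d m m' Δ → ((min (d - m') (K * m) : ℕ) : ℝ) ≤ b * Δ) :
    C / baselineRate K d m m' ≤ ENNReal.ofReal b := by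
  obtain ⟨Δ, hΔ, rfl⟩ := hC
  have h0 := hΔ.pos hK hm hd
  rw [gain_eq _ _ _ _ h0]
  refine ENNReal.ofReal_le_ofReal ?_
  rw [div_le_iff₀ h0]
  exact hb Δ hΔ

theorem ofReal_div_four (d : ℕ) : ENNReal.ofReal (d / 4) = (d : ℝ≥0∞) / 4 := by
  rw [ENNReal.ofReal_div_of_pos (by norm_num), ENNReal.ofReal_natCast, ENNReal.ofReal_ofNat]

theorem ofReal_div_four_add_one (d : ℕ) :
    ENNReal.ofReal (d / 4 + 1) = (d : ℝ≥0∞) / 4 + 1 := by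
  rw [ENNReal.ofReal_add (by positivity) (by norm_num), ofReal_div_four, ENNReal.ofReal_one]

theorem gain_common (r : ℕ) :
    (1 / ENNReal.ofReal 1) / baselineRate (r + 1) (r * (r + 1) + 1) 1 (r * r) =
      ((r + 1 : ℕ) : ℝ≥0∞) := by
  have hsq : r * (r + 1) = r * r + r := by ring
  rw [gain_eq _ _ _ _ one_pos, mul_one, div_one, ENNReal.ofReal_natCast]
  congr 1
  omega

theorem gainUsers_eq (hK : 0 < K) : gainUsers K = K := by
  refine le_antisymm (sSup_le ?_) ?_
  · rintro _ ⟨p, _, d, m, m', C, hm, hd, hC, rfl⟩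
    rw [← ENNReal.ofReal_natCast]
    exact gain_le_ofReal hC hK hm hd fun Δ hΔ => hΔ.le_users_mul hK hm hd
  · obtain ⟨r, rfl⟩ : ∃ r, K = r + 1 := ⟨K - 1, by omega⟩
    have hsq : r * (r + 1) = r * r + r := by ring
    exact le_sSup ⟨2, ⟨Nat.prime_two⟩, r * (r + 1) + 1, 1, r * r, _, one_pos, by omega,
      ⟨1, @isGenericCost_one 2 ⟨Nat.prime_two⟩ r, rfl⟩, (gain_common r).symm⟩

theorem le_gainDim_common (r : ℕ) : ((r + 1 : ℕ) : ℝ≥0∞) ≤ gainDim (r * (r + 1) + 1) := by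
  have hsq : r * (r + 1) = r * r + r := by ring
  exact le_sSup ⟨2, ⟨Nat.prime_two⟩, r + 1, 1, r * r, _, by omega, one_pos, by omega,
    ⟨1, @isGenericCost_one 2 ⟨Nat.prime_two⟩ r, rfl⟩, (gain_common r).symm⟩

theorem gainDim_le_nat {c : ℕ} (hc0 : 0 < c) (hc : ∀ x y : ℕ, x + y = d + 1 → y * x ≤ c * d) :
    gainDim d ≤ c := by
  refine sSup_le ?_
  rintro _ ⟨p, _, K, m, m', C, hK, hm, hd, hC, rfl⟩
  rw [← ENNReal.ofReal_natCast]
  exact gain_le_ofReal hC hK hm hd fun Δ hΔ => hΔ.le_nat_mul hK hm hd hc0 hc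

theorem gainDim_three : gainDim 3 = 2 := by
  refine le_antisymm ?_ ?_
  · refine (gainDim_le_nat (c := 2) (by omega) fun x y h => ?_).trans (by norm_num)
    obtain rfl : y = 4 - x := by omega
    have : x ≤ 4 := by omega
    interval_cases x <;> norm_num
  · simpa using le_gainDim_common 1

theorem gainDim_seven : gainDim 7 = 3 := by
  refine le_antisymm ?_ ?_
  · refine (gainDim_le_nat (c := 3) (by omega) fun x y h => ?_).trans (by norm_num)
    obtain rfl : y = 8 - x := by omega
    have : x ≤ 8 := by omega
    interval_cases x <;> norm_num
  · simpa using le_gainDim_common 2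

theorem gainDim_le (h3 : d ≠ 3) (h7 : d ≠ 7) : gainDim d ≤ (d : ℝ≥0∞) / 4 + 1 := by
  refine sSup_le ?_
  rintro _ ⟨p, _, K, m, m', C, hK, hm, hd, hC, rfl⟩
  rw [← ofReal_div_four_add_one]
  exact gain_le_ofReal hC hK hm hd fun Δ hΔ => hΔ.le_mul_of_ne hK hm hd h3 h7

theorem gainDimManyUsers_le (d : ℕ) : gainDimManyUsers d ≤ (d : ℝ≥0∞) / 4 + 1 := by
  refine sSup_le ?_
  rintro _ ⟨p, _, K, m, m', C, hK, hm, hd, hKd, hC, rfl⟩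
  rw [← ofReal_div_four_add_one]
  exact gain_le_ofReal hC hK hm hd fun Δ hΔ => hΔ.le_mul_of_manyUsers hK hm hd hKd

theorem gainDimManyUsers_le_gainDim (d : ℕ) : gainDimManyUsers d ≤ gainDim d := by
  refine sSup_le_sSup ?_
  rintro _ ⟨p, hp, K, m, m', C, hK, hm, hd, _, hC, rfl⟩
  exact ⟨p, hp, K, m, m', C, hK, hm, hd, hC, rfl⟩

/-- For `m' = (d - 1) / 2`, rounded down, both `m' + 1` and `d - m'` are at least `d / 2`. This is
the choice behind the lower bounds `d / 4`. -/
theorem sq_le_four_mul_half (d : ℕ) : (d : ℝ) ^ 2 ≤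
    4 * ((((d - 1) / 2 : ℕ) + 1 : ℝ) * ((d - (d - 1) / 2 : ℕ) : ℝ)) := by
  have h : ∀ x y : ℕ, d ≤ 2 * x → d ≤ 2 * y → (d : ℝ) ^ 2 ≤ 4 * ((x : ℝ) * y) := by
    intro x y hx hy
    have := Nat.mul_le_mul hx hy
    have : d ^ 2 ≤ 4 * (x * y) := by nlinarith
    exact_mod_cast this
  have := h ((d - 1) / 2 + 1) (d - (d - 1) / 2) (by omega) (by omega)
  push_cast at this
  exact this

theorem le_gainDimManyUsers (hd : 0 < d) : (d : ℝ≥0∞) / 4 ≤ gainDimManyUsers d := by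
  have hd' : (0 : ℝ) < d := by exact_mod_cast hd
  have : Fact (Nat.Prime 2) := ⟨Nat.prime_two⟩
  refine le_trans ?_ (le_sSup ⟨2, ⟨Nat.prime_two⟩, d, 1, (d - 1) / 2, _, hd, one_pos, by omega,
    Nat.div_le_self _ _, ⟨_, isGenericCost_of_le 2 (by omega) le_rfl, rfl⟩, rfl⟩)
  rw [gain_eq _ _ _ _ (by positivity), ← ofReal_div_four]
  refine ENNReal.ofReal_le_ofReal ?_
  rw [mul_one, min_eq_left (Nat.sub_le _ _)]
  have h := sq_le_four_mul_half d
  rw [div_div_eq_mul_div, div_le_div_iff₀ (by norm_num) hd']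
  linarith

theorem le_envelopeGainDim (hd : 0 < d) : (d : ℝ≥0∞) / 4 ≤ envelopeGainDim d := by
  have hd' : (0 : ℝ) < d := by exact_mod_cast hd
  refine le_trans ?_ (le_sSup ⟨d, 1, (d - 1) / 2, hd, one_pos, by omega, rfl⟩)
  rw [envelopeGain_eq _ one_pos (by omega), ← ofReal_div_four]
  refine ENNReal.ofReal_le_ofReal ?_
  rw [mul_one, min_eq_left (Nat.sub_le _ _), Nat.cast_one, one_mul]
  have h := sq_le_four_mul_half d
  rw [div_le_div_iff₀ (by norm_num) hd']
  linarith

theorem envelopeGainDim_le (d : ℕ) : envelopeGainDim d ≤ (d : ℝ≥0∞) / 4 + 1 := by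
  refine sSup_le ?_
  rintro _ ⟨K, m, m', hK, hm, hd, rfl⟩
  rw [envelopeGain_eq K hm hd, ← ofReal_div_four_add_one]
  refine ENNReal.ofReal_le_ofReal ?_
  have hmd : (0 : ℝ) < m * d := by
    have : 0 < m * d := Nat.mul_pos hm (by omega)
    exact_mod_cast this
  rw [div_le_iff₀ hmd]
  refine le_trans ?_ (sub_mul_add_le hm hd)
  rw [mul_comm]
  gcongr
  exact min_le_sub hd

theorem envelopeGainUsers_eq (hK : 0 < K) : envelopeGainUsers K = K := by
  refine le_antisymm (sSup_le ?_) ?_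
  · rintro _ ⟨d, m, m', hm, hd, rfl⟩
    rw [envelopeGain_eq K hm hd, ← ENNReal.ofReal_natCast]
    refine ENNReal.ofReal_le_ofReal ?_
    have hmd : (0 : ℝ) < m * d := by
      have : 0 < m * d := Nat.mul_pos hm (by omega)
      exact_mod_cast this
    rw [div_le_iff₀ hmd]
    exact envelope_le_users hK hm hd
  -- The value `K` is approached along `m = 1`, `m' = j`, `d = K + j`, where the two baseline rates
  -- coincide.
  · have hlim : Tendsto (fun j : ℕ => ((1 + j : ℝ) * K) / (1 * ((K + j : ℕ) : ℝ))) atTop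
        (𝓝 K) := by
      have h1 : Tendsto (fun j : ℕ => (K : ℝ) - (K - 1) * K / ((j + K : ℕ) : ℝ)) atTop
          (𝓝 (K - 0)) := by
        refine tendsto_const_nhds.sub ?_
        exact (tendsto_add_atTop_iff_nat K).2
          (tendsto_const_div_atTop_nhds_zero_nat (((K : ℝ) - 1) * K))
      rw [sub_zero] at h1
      refine h1.congr fun j => ?_
      have : (0 : ℝ) < K := by exact_mod_cast hK
      push_cast
      have : (j : ℝ) + K ≠ 0 := by positivity
      have : (K : ℝ) + j ≠ 0 := by positivity
      field_simp
      ring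
    have h2 := (ENNReal.continuous_ofReal.tendsto (K : ℝ)).comp hlim
    rw [ENNReal.ofReal_natCast] at h2
    refine le_of_tendsto' h2 fun j => le_sSup ⟨K + j, 1, j, one_pos, by omega, ?_⟩
    rw [envelopeGain_eq _ one_pos (by omega), mul_one, Nat.add_sub_cancel, min_self]
    simp

end Extremal

end

end LCBC

theorem mainTheorem6 :
    (∀ K : ℕ, 0 < K → LCBC.gainUsers K = (K : ℝ≥0∞) ∧ LCBC.envelopeGainUsers K = (K : ℝ≥0∞)) ∧
    (∀ d : ℕ, 0 < d →
      (d : ℝ≥0∞) / 4 ≤ LCBC.gainDim d ∧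
      (d ≠ 3 → d ≠ 7 → LCBC.gainDim d ≤ (d : ℝ≥0∞) / 4 + 1) ∧
      LCBC.gainDimManyUsers d ∈ Set.Icc ((d : ℝ≥0∞) / 4) ((d : ℝ≥0∞) / 4 + 1) ∧
      LCBC.envelopeGainDim d ∈ Set.Icc ((d : ℝ≥0∞) / 4) ((d : ℝ≥0∞) / 4 + 1)) ∧
    LCBC.gainDim 3 = 2 ∧ LCBC.gainDim 7 = 3 :=
  ⟨fun _ hK => ⟨LCBC.gainUsers_eq hK, LCBC.envelopeGainUsers_eq hK⟩,
    fun d hd => ⟨(LCBC.le_gainDimManyUsers hd).trans (LCBC.gainDimManyUsers_le_gainDim d),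
      LCBC.gainDim_le, ⟨LCBC.le_gainDimManyUsers hd, LCBC.gainDimManyUsers_le d⟩,
      ⟨LCBC.le_envelopeGainDim hd, LCBC.envelopeGainDim_le d⟩⟩,
    LCBC.gainDim_three, LCBC.gainDim_seven⟩
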